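/- **Theorem 5.** Let $M,N\ge 0$ be integers and let $\varepsilon,\delta\ge 0$ be rational numbers with $\delta<2$. Assume that $(\varepsilon,\delta)$ is nondegenerate, that is, $\nu\varepsilon-(N-k)\delta+2\neq 0$ for all integers $0\le\nu\le M$ and $0\le k\le N-1$. For $b=(b',b'')\in\mathbb{C}^{M+1}\times\mathbb{C}^{N+1}$ put $P(b;z)=\sum_{\mu=0}^{M}b'_\mu z^\mu$ and $Q(b;z)=\sum_{\nu=0}^{N}b''_\nu z^\nu$. For a polynomial $F(z)=\sum_\mu f_\mu z^\mu$ let $|||F|||=\sum_\mu|f_\mu|$. Let $B$ be the open unit disk in $\mathbb{C}$ and $dV$ the Lebesgue measure. An absolute rational power (ARP) with integer coefficients in variables $X=(X_1,\dots,X_n)$ is an expression $$T(X)=\frac{\bigl(\sum_{i=1}^{I}|P_i(X)|^2\bigr)^{\varepsilon_0/2}}{\bigl(\sum_{j=1}^{J}|Q_j(X)|^2\bigr)^{\delta_0/2}}$$ with $P_i,Q_j\in\mathbb{Z}[X_1,\dots,X_n]$, at least one $P_i$ nonzero, and rational $\varepsilon_0,\delta_0\ge 0$. Its strict domain is the set of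 $x\in\mathbb{C}^n$ at which at least one $P_i$ and at least one $Q_j$ do not vanish; there $T$ takes values in $(0,\infty)$. Then there are an integer-coefficient ARP $T(B',B'')$ in the $(M+1)+(N+1)$ variables $B'=(B'_0,\dots,B'_M)$, $B''=(B''_0,\dots,B''_N)$, a number $s_1\in(0,1)$ and constants $0<c,C<\infty$, all depending only on $M,N,\varepsilon,\delta$, such that for every $b=(b',b'')$ with $b'\neq 0$, with all roots of $Q(b;z)$ simple, and with $|||Q(b;z)-z^N|||<s_1$: 1. $b$ lies in the strict domain of $T$; 2. the integral below is finite, and $$c\,T(b)\le\int_B\frac{|P(b;z)|^{\varepsilon}}{|Q(b;z)|^{\delta}}\,dV\le C\,T(b).$$ -/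

import Mathlib

noncomputable section

/-- An absolute rational power (ARP) in the variables `σ` with coefficients in `A`: a formal
expression `(∑ i, |P i| ^ 2) ^ (ε / 2) / (∑ j, |Q j| ^ 2) ^ (δ / 2)`, where `P` and `Q` are finite
families of polynomials with coefficients in `A`, at least one `P i` is nonzero, and `ε`, `δ` are
nonnegative rational numbers. -/
structure ARP (σ A : Type*) [CommRing A] where
  I : ℕ
  J : ℕ
  P : Fin I → MvPolynomial σ A
  Q : Fin J → MvPolynomial σ A
  ε : ℚ
  δ : ℚ
  ε_nonneg : 0 ≤ ε
  δ_nonneg : 0 ≤ δ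
  exists_P_ne_zero : ∃ i, P i ≠ 0

namespace ARP

variable {σ A : Type*} [CommRing A] [Algebra A ℂ]

/-- The value `K(z)` of the numerator at `z`. -/
def num (R : ARP σ A) (z : σ → ℂ) : ℝ :=
  (∑ i, ‖MvPolynomial.aeval z (R.P i)‖ ^ 2) ^ ((R.ε : ℝ) / 2)

/-- The value `L(z)` of the denominator at `z`. -/
def den (R : ARP σ A) (z : σ → ℂ) : ℝ :=
  (∑ j, ‖MvPolynomial.aeval z (R.Q j)‖ ^ 2) ^ ((R.δ : ℝ) / 2)

/-- The value `K(z) / L(z)`; it is only used on the strict domain, where it lies in `(0, ∞)`. -/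
def eval (R : ARP σ A) (z : σ → ℂ) : ℝ :=
  R.num z / R.den z

/-- The strict domain: the points that lie neither on the variety defined by the numerator (the
common zeros of the `P i`) nor on the variety defined by the denominator (the common zeros of the
`Q j`). -/
def strictDomain (R : ARP σ A) : Set (σ → ℂ) :=
  {z | (∃ i, MvPolynomial.aeval z (R.P i) ≠ 0) ∧ (∃ j, MvPolynomial.aeval z (R.Q j) ≠ 0)}

end ARP

/-- The polynomial `∑ μ, b μ * Z ^ μ` with coefficient vector `b = (b 0, …, b d)`. -/
def polyOfCoeffs {d : ℕ} (b : Fin (d + 1) → ℂ) : Polynomial ℂ :=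
  ∑ μ : Fin (d + 1), Polynomial.C (b μ) * Polynomial.X ^ (μ : ℕ)

/-- The coefficient norm of a polynomial: the sum of the absolute values of its coefficients. -/
def coeffNorm (Q : Polynomial ℂ) : ℝ :=
  ∑ μ ∈ Q.support, ‖Q.coeff μ‖

/-- The pair `(ε, δ)` is nondegenerate for the degrees `M` and `N`. -/
def Nondegenerate (M N : ℕ) (ε δ : ℚ) : Prop :=
  ∀ ν k : ℕ, ν ≤ M → k < N → (ν : ℚ) * ε - ((N : ℚ) - (k : ℚ)) * δ + 2 ≠ 0

end

/-! The smallness hypothesis forces the roots `α j` of `Q` into the disc of radius `1/4` and the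
modulus of its leading coefficient into `[1/2, 2]`. If `α i` is the root nearest to `z`, at distance
`ρ`, then `|Q(z)|` is comparable to `∏ j, max ρ |α i - α j|`, and `|P(z)| ^ ε` is bounded by a
constant times `∑ ν, |p_ν| ^ ε * ρ ^ (ν ε)`, where `p_ν` are the Taylor coefficients of `P` at `α
i`. Between consecutive root distances each term, area element included, is a pure power `ρ ^ (a -
1) dρ` with `a = ν ε + 2 - k δ`, where `k` counts the roots within `ρ` of `α i`. Nondegeneracy means
`a ≠ 0`, so no logarithm appears and one end of the range dominates; `δ < 2` gives `a > 0` for `k =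
1`, hence convergence at the root. So the integral is controlled by its values at the scales `|α i -
α l|` and at one outer scale (`exists_scale_le`, `exists_setIntegral_le`). Conversely, integrating
over the disc of radius `|α i - α l|` about `α i` shows that each of these values is needed
(`exists_le_setIntegral`).

The resulting `scaleSum` is comparable to the `D`-th root of `rootSize`, `D` a common denominator of
`ε` and `δ`. This is a quotient of two sums of absolute values of integer polynomials in `b'` and
the roots, invariant under permuting the roots. To return to coefficients, all permuted values of
the polynomials in such a sum are taken as the roots of one monic polynomial
(`exists_symmetrization`). Its coefficients are symmetric in `α`, hence integer polynomials in `b`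
up to powers of the leading coefficient, and suitable powers of them measure the size of the largest
root. Numerator and denominator of the ARP arise in this way (`exists_arp_comparable_rootSize`). -/

/-! ### Symmetric functions of the roots as polynomials in the coefficients. -/

open MvPolynomial in
/-- Evaluation at parameters `b` and roots `α` of a polynomial in the roots whose coefficients are
integer polynomials in the parameters. -/
noncomputable def evalRoots {κ : Type*} {N : ℕ} (b : κ → ℂ) (α : Fin N → ℂ) :
    MvPolynomial (Fin N) (MvPolynomial κ ℤ) →+* ℂ :=
  eval₂Hom (aeval b : MvPolynomial κ ℤ →ₐ[ℤ] ℂ).toRingHom α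

/-- The vector `b` consists of the coefficients of a polynomial with roots `α`. -/
def HasRoots {N : ℕ} (b : Fin (N + 1) → ℂ) (α : Fin N → ℂ) : Prop :=
  polyOfCoeffs b = Polynomial.C (b (Fin.last N)) * ∏ i, (Polynomial.X - Polynomial.C (α i))

lemma coeff_polyOfCoeffs {d : ℕ} (b : Fin (d + 1) → ℂ) (k : Fin (d + 1)) :
    (polyOfCoeffs b).coeff k = b k := by
  simp only [polyOfCoeffs, Polynomial.finsetSum_coeff, Polynomial.coeff_C_mul,
    Polynomial.coeff_X_pow]
  rw [Finset.sum_eq_single k]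
  · simp
  · intro j _ hj
    have : (k : ℕ) ≠ j := fun h => hj (Fin.ext h.symm)
    simp [this]
  · simp

section roots

variable {κ : Type*} {N : ℕ}

lemma evalRoots_C (b : κ → ℂ) (α : Fin N → ℂ) (r : MvPolynomial κ ℤ) :
    evalRoots b α (MvPolynomial.C r) = MvPolynomial.aeval b r := by
  simp [evalRoots]

lemma evalRoots_X (b : κ → ℂ) (α : Fin N → ℂ) (i : Fin N) :
    evalRoots b α (MvPolynomial.X i) = α i := by
  simp [evalRoots]

lemma evalRoots_rename (b : κ → ℂ) (α : Fin N → ℂ) (e : Fin N → Fin N)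
    (F : MvPolynomial (Fin N) (MvPolynomial κ ℤ)) :
    evalRoots b α (MvPolynomial.rename e F) = evalRoots b (α ∘ e) F := by
  simp [evalRoots, MvPolynomial.eval₂Hom_rename]

lemma evalRoots_esymm (b : κ → ℂ) (α : Fin N → ℂ) (n : ℕ) :
    evalRoots b α (MvPolynomial.esymm (Fin N) (MvPolynomial κ ℤ) n) =
      (Finset.univ.val.map α).esymm n := by
  simp only [MvPolynomial.esymm, map_sum, map_prod, evalRoots_X, Finset.esymm_map_val]

/-- Vieta's formula, kept free of division by the leading coefficient. The index `castSucc i.rev`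
has value `N - (i + 1)`. -/
lemma HasRoots.mul_esymm {b : Fin (N + 1) → ℂ} {α : Fin N → ℂ} (h : HasRoots b α) (i : Fin N) :
    b (Fin.last N) * (Finset.univ.val.map α).esymm (i + 1) =
      (-1) ^ ((i : ℕ) + 1) * b (Fin.castSucc i.rev) := by
  have h1 : (polyOfCoeffs b).coeff (Fin.castSucc i.rev : Fin (N + 1)) = b (Fin.castSucc i.rev) :=
    coeff_polyOfCoeffs b _
  have hprod : ∏ j, (Polynomial.X - Polynomial.C (α j)) =
      ((Finset.univ.val.map α).map fun t => Polynomial.X - Polynomial.C t).prod := by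
    rw [Multiset.map_map]; rfl
  have hcard : Multiset.card (Finset.univ.val.map α) = N := by simp
  have hi : ((Fin.castSucc i.rev : Fin (N + 1)) : ℕ) = N - (i + 1) := by simp [Fin.val_rev]
  rw [h, Polynomial.coeff_C_mul, hprod, Multiset.prod_X_sub_C_coeff _ (by rw [hcard, hi]; omega),
    hcard, hi, show N - (N - ((i : ℕ) + 1)) = i + 1 by omega] at h1
  rw [← h1]
  have : ((-1 : ℂ) ^ ((i : ℕ) + 1)) * (-1) ^ ((i : ℕ) + 1) = 1 := by
    rw [← mul_pow]; simp
  linear_combination (-(b (Fin.last N) * (Finset.univ.val.map α).esymm (i + 1))) * this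

/-- Each elementary symmetric function is a coefficient ratio with denominator `b'' (Fin.last N)`;
the exponent `t` records how often that denominator has to be cleared. -/
lemma exists_homogenization (E : MvPolynomial (Fin N) (MvPolynomial κ ℤ)) :
    ∃ (t : ℕ) (P : MvPolynomial (κ ⊕ Fin (N + 1)) ℤ),
      ∀ (b' : κ → ℂ) (b'' : Fin (N + 1) → ℂ) (α : Fin N → ℂ), HasRoots b'' α →
        MvPolynomial.aeval (Sum.elim b' b'') P = b'' (Fin.last N) ^ t *
          evalRoots b' α (MvPolynomial.aeval
            (fun i : Fin N => MvPolynomial.esymm (Fin N) (MvPolynomial κ ℤ) (i + 1)) E) := by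
  induction E using MvPolynomial.induction_on with
  | C r =>
    refine ⟨0, MvPolynomial.rename Sum.inl r, fun b' b'' α _ => ?_⟩
    rw [MvPolynomial.aeval_rename, Sum.elim_comp_inl, MvPolynomial.aeval_C,
      MvPolynomial.algebraMap_eq, evalRoots_C, pow_zero, one_mul]
  | add p q hp hq =>
    obtain ⟨t, P, hP⟩ := hp
    obtain ⟨u, Q, hQ⟩ := hq
    refine ⟨t + u, MvPolynomial.X (Sum.inr (Fin.last N)) ^ u * P +
      MvPolynomial.X (Sum.inr (Fin.last N)) ^ t * Q, fun b' b'' α h => ?_⟩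
    simp only [map_add, map_mul, map_pow, MvPolynomial.aeval_X, Sum.elim_inr, hP b' b'' α h,
      hQ b' b'' α h]
    ring
  | mul_X p i hp =>
    obtain ⟨t, P, hP⟩ := hp
    refine ⟨t + 1, P * ((-1) ^ ((i : ℕ) + 1) * MvPolynomial.X (Sum.inr (Fin.castSucc i.rev))),
      fun b' b'' α h => ?_⟩
    have := h.mul_esymm i
    simp only [map_mul, map_pow, map_neg, map_one, MvPolynomial.aeval_X, Sum.elim_inr,
      hP b' b'' α h, evalRoots_esymm, ← this]
    ring

lemma exists_homogenization_of_isSymmetric {E : MvPolynomial (Fin N) (MvPolynomial κ ℤ)}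
    (hE : E.IsSymmetric) :
    ∃ (t : ℕ) (P : MvPolynomial (κ ⊕ Fin (N + 1)) ℤ),
      ∀ (b' : κ → ℂ) (b'' : Fin (N + 1) → ℂ) (α : Fin N → ℂ), HasRoots b'' α →
        MvPolynomial.aeval (Sum.elim b' b'') P =
          b'' (Fin.last N) ^ t * evalRoots b' α E := by
  obtain ⟨G, hG⟩ := MvPolynomial.esymmAlgHom_fin_surjective (MvPolynomial κ ℤ) (le_refl N)
    ⟨E, (MvPolynomial.mem_symmetricSubalgebra E).2 hE⟩
  obtain ⟨t, P, h⟩ := exists_homogenization G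
  refine ⟨t, P, fun b' b'' α hr => ?_⟩
  rw [h b' b'' α hr, ← MvPolynomial.esymmAlgHom_apply, hG]

end roots

/-! ### Size of the roots against size of the coefficients. -/

/-- The coefficient of index `m` is homogeneous of degree `K - m` in the roots. The power `K! / (K -
m)`, an exact division, brings all coefficients to the common degree `K!`. -/
lemma norm_coeff_prod_X_sub_C_pow_le {K : ℕ} (w : Fin K → ℂ) {m : ℕ} (hm : m < K) :
    ‖(∏ k, (Polynomial.X - Polynomial.C (w k))).coeff m‖ ^ (K.factorial / (K - m)) ≤
      (2 ^ K) ^ K.factorial * (∑ k, ‖w k‖) ^ K.factorial := by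
  set s := ∑ k, ‖w k‖
  have hs : 0 ≤ s := Finset.sum_nonneg fun _ _ => norm_nonneg _
  have hmon : (∏ k, (Polynomial.X - Polynomial.C (w k))).Monic :=
    Polynomial.monic_prod_of_monic _ _ fun k _ => Polynomial.monic_X_sub_C _
  have hdeg : (∏ k, (Polynomial.X - Polynomial.C (w k))).natDegree = K := by
    simp [Polynomial.natDegree_prod_of_monic _ _ fun k _ => Polynomial.monic_X_sub_C (w k)]
  have h1 := Polynomial.coeff_le_of_roots_le (f := RingHom.id ℂ) (B := s) m hmon
    (IsAlgClosed.splits _) (by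
      intro z hz
      rw [Polynomial.map_id, Polynomial.mem_roots hmon.ne_zero, Polynomial.IsRoot.def,
        Polynomial.eval_prod, Finset.prod_eq_zero_iff] at hz
      obtain ⟨k, -, hk⟩ := hz
      rw [Polynomial.eval_sub, Polynomial.eval_X, Polynomial.eval_C, sub_eq_zero] at hk
      rw [hk]
      exact Finset.single_le_sum (f := fun k => ‖w k‖) (fun _ _ => norm_nonneg _)
        (Finset.mem_univ k))
  rw [Polynomial.map_id, hdeg] at h1
  have hd : (K - m) ∣ K.factorial := Nat.dvd_factorial (by omega) (by omega)
  have h2 : ‖(∏ k, (Polynomial.X - Polynomial.C (w k))).coeff m‖ ≤ s ^ (K - m) * 2 ^ K := by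
    refine h1.trans ?_
    gcongr
    exact_mod_cast Nat.choose_le_two_pow _ _
  calc _ ≤ (s ^ (K - m) * 2 ^ K) ^ (K.factorial / (K - m)) := by gcongr
    _ = (2 ^ K) ^ (K.factorial / (K - m)) * s ^ K.factorial := by
        rw [mul_pow, ← pow_mul, Nat.mul_div_cancel' hd, mul_comm]
    _ ≤ _ := by
        gcongr
        · exact one_le_pow₀ (by norm_num)
        · exact Nat.div_le_self _ _

/-- Evaluating at the root of largest modulus, the leading term is balanced by the `K` lower ones,
so the largest of these is at least `1 / K` of it. The other factor `K` compares the sum of the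
moduli with their maximum. -/
lemma exists_sum_norm_pow_le_norm_coeff {K : ℕ} (w : Fin K → ℂ) :
    (∑ k, ‖w k‖) = 0 ∨ ∃ m < K, (∑ k, ‖w k‖) ^ K.factorial ≤ ((K : ℝ) ^ 2) ^ K.factorial *
      ‖(∏ k, (Polynomial.X - Polynomial.C (w k))).coeff m‖ ^ (K.factorial / (K - m)) := by
  rcases Nat.eq_zero_or_pos K with rfl | hK
  · left; simp
  have : Nonempty (Fin K) := ⟨⟨0, hK⟩⟩
  obtain ⟨k₀, -, hk₀⟩ := Finset.exists_max_image Finset.univ (fun k => ‖w k‖) Finset.univ_nonempty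
  set p := ∏ k, (Polynomial.X - Polynomial.C (w k)) with hp
  have hmon : p.Monic := Polynomial.monic_prod_of_monic _ _ fun k _ => Polynomial.monic_X_sub_C _
  have hdeg : p.natDegree = K := by
    simp [hp, Polynomial.natDegree_prod_of_monic _ _ fun k _ => Polynomial.monic_X_sub_C (w k)]
  have hroot : p.eval (w k₀) = 0 := by
    rw [hp, Polynomial.eval_prod]
    exact Finset.prod_eq_zero (Finset.mem_univ k₀) (by simp)
  rw [Polynomial.eval_eq_sum_range, hdeg, Finset.sum_range_succ] at hroot
  have hlead : p.coeff K = 1 := by rw [← hdeg]; exact hmon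
  rw [hlead, one_mul] at hroot
  have hle : ‖w k₀‖ ^ K ≤ ∑ m ∈ Finset.range K, ‖p.coeff m‖ * ‖w k₀‖ ^ m := by
    rw [← norm_pow, eq_neg_of_add_eq_zero_right hroot, norm_neg]
    refine (norm_sum_le _ _).trans (le_of_eq ?_)
    simp [norm_pow]
  by_cases hw : w k₀ = 0
  · left
    refine Finset.sum_eq_zero fun k _ => le_antisymm ?_ (norm_nonneg _)
    simpa [hw] using hk₀ k (Finset.mem_univ k)
  right
  have hw' : 0 < ‖w k₀‖ := norm_pos_iff.2 hw
  obtain ⟨m, hm, hmax⟩ := Finset.exists_max_image (Finset.range K)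
    (fun m => ‖p.coeff m‖ * ‖w k₀‖ ^ m) ⟨0, by simpa using hK⟩
  rw [Finset.mem_range] at hm
  refine ⟨m, hm, ?_⟩
  have h1 : ‖w k₀‖ ^ K ≤ K * (‖p.coeff m‖ * ‖w k₀‖ ^ m) := by
    refine hle.trans ((Finset.sum_le_card_nsmul _ _ _ hmax).trans (le_of_eq ?_))
    simp
  have h2 : ‖w k₀‖ ^ (K - m) ≤ K * ‖p.coeff m‖ := by
    have : ‖w k₀‖ ^ K = ‖w k₀‖ ^ (K - m) * ‖w k₀‖ ^ m := by
      rw [← pow_add]; congr 1; omega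
    rw [this, ← mul_assoc] at h1
    exact le_of_mul_le_mul_right h1 (pow_pos hw' _)
  have hd : (K - m) ∣ K.factorial := Nat.dvd_factorial (by omega) (by omega)
  have h3 : ‖w k₀‖ ^ K.factorial ≤ (K : ℝ) ^ K.factorial *
      ‖p.coeff m‖ ^ (K.factorial / (K - m)) := by
    calc ‖w k₀‖ ^ K.factorial = (‖w k₀‖ ^ (K - m)) ^ (K.factorial / (K - m)) := by
          rw [← pow_mul, Nat.mul_div_cancel' hd]
      _ ≤ (K * ‖p.coeff m‖) ^ (K.factorial / (K - m)) := by gcongr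
      _ = (K : ℝ) ^ (K.factorial / (K - m)) * ‖p.coeff m‖ ^ (K.factorial / (K - m)) := mul_pow ..
      _ ≤ _ := by
          gcongr
          · exact_mod_cast hK
          · exact Nat.div_le_self _ _
  have h4 : (∑ k, ‖w k‖) ≤ K * ‖w k₀‖ := by
    refine (Finset.sum_le_card_nsmul _ _ _ hk₀).trans (le_of_eq ?_)
    simp
  calc (∑ k, ‖w k‖) ^ K.factorial ≤ (K * ‖w k₀‖) ^ K.factorial := by gcongr
    _ = (K : ℝ) ^ K.factorial * ‖w k₀‖ ^ K.factorial := mul_pow ..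
    _ ≤ (K : ℝ) ^ K.factorial * ((K : ℝ) ^ K.factorial *
      ‖p.coeff m‖ ^ (K.factorial / (K - m))) := by gcongr
    _ = _ := by ring

/-! ### Symmetrization over all orderings of the roots. -/

section symmetrization

variable {κ : Type*} {N : ℕ}

/-- A permutation of the variables only permutes the factors, since all permutations occur in the
index set. -/
lemma isSymmetric_coeff_prod_X_sub_C {ι : Type*} [Fintype ι] {R : Type*} [CommRing R]
    (F : ι → MvPolynomial (Fin N) R) (m : ℕ) :
    ((∏ x : Equiv.Perm (Fin N) × ι, (Polynomial.X -
      Polynomial.C (MvPolynomial.rename x.1 (F x.2)))).coeff m).IsSymmetric := by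
  intro e
  rw [← AlgHom.coe_toRingHom, ← Polynomial.coeff_map, Polynomial.map_prod]
  congr 1
  refine Fintype.prod_equiv ((Equiv.mulLeft e).prodCongr (Equiv.refl ι)) _ _ fun x => ?_
  simp [MvPolynomial.rename_rename, Equiv.Perm.coe_mul]

/-- The values `F k` at all reorderings of `α` are the roots of a monic polynomial with coefficients
symmetric in `α`. Raised to the powers equalizing their degrees, these coefficients are together
comparable to the `L`-th power of the sum of the moduli, `L = K!`; squaring gives the shape required
in an ARP. -/
lemma exists_symmetrization {ι : Type*} [Fintype ι]
    (F : ι → MvPolynomial (Fin N) (MvPolynomial κ ℤ)) :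
    ∃ (K : ℕ) (P : Fin K → MvPolynomial (κ ⊕ Fin (N + 1)) ℤ) (L : ℕ) (c C : ℝ),
      0 < L ∧ 0 < c ∧ 0 < C ∧
      ∀ (b' : κ → ℂ) (b'' : Fin (N + 1) → ℂ) (α : Fin N → ℂ), HasRoots b'' α →
        1 / 2 ≤ ‖b'' (Fin.last N)‖ → ‖b'' (Fin.last N)‖ ≤ 2 →
        c * (∑ τ : Equiv.Perm (Fin N), ∑ k, ‖evalRoots b' (α ∘ τ) (F k)‖) ^ (2 * L) ≤
            ∑ m, ‖MvPolynomial.aeval (Sum.elim b' b'') (P m)‖ ^ 2 ∧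
        ∑ m, ‖MvPolynomial.aeval (Sum.elim b' b'') (P m)‖ ^ 2 ≤
          C * (∑ τ : Equiv.Perm (Fin N), ∑ k, ‖evalRoots b' (α ∘ τ) (F k)‖) ^ (2 * L) := by
  classical
  set K := Fintype.card (Equiv.Perm (Fin N) × ι) with hKdef
  let e : Fin K ≃ Equiv.Perm (Fin N) × ι := (Fintype.equivFin _).symm
  choose t P hP using fun m : Fin K =>
    exists_homogenization_of_isSymmetric (isSymmetric_coeff_prod_X_sub_C F m)
  set L := K.factorial with hL
  set u : Fin K → ℕ := fun m => L / (K - m)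
  -- `T` bounds every exponent of the leading coefficient, so the powers that occur lie between `2 ^
  -- (-T)` and `2 ^ T`. The summands `1` in `B` and in the upper constant keep these positive when
  -- `K = 0`.
  set T : ℕ := ∑ m, t m * u m
  have hTm : ∀ m, t m * u m ≤ T := fun m =>
    Finset.single_le_sum (f := fun m => t m * u m) (fun _ _ => Nat.zero_le _) (Finset.mem_univ m)
  set A : ℝ := 2 ^ T * (2 ^ K) ^ L
  set B : ℝ := ((K : ℝ) ^ 2) ^ L * 2 ^ T + 1
  have hA : 0 < A := by positivity
  have hB : 0 < B := by positivity
  refine ⟨K, fun m => P m ^ u m, L, (B ^ 2)⁻¹, K * A ^ 2 + 1, K.factorial_pos, by positivity,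
    by positivity, fun b' b'' α hr hlo hhi => ?_⟩
  set w : Fin K → ℂ := fun k => evalRoots b' (α ∘ (e k).1) (F (e k).2) with hw
  have hsum : ∑ τ : Equiv.Perm (Fin N), ∑ k, ‖evalRoots b' (α ∘ τ) (F k)‖ = ∑ k, ‖w k‖ := by
    rw [← Fintype.sum_prod_type', ← e.sum_comp]
  have hcoeff : ∀ m : Fin K, MvPolynomial.aeval (Sum.elim b' b'') (P m) =
      b'' (Fin.last N) ^ t m * (∏ k, (Polynomial.X - Polynomial.C (w k))).coeff m := by
    intro m
    rw [hP m b' b'' α hr, ← Polynomial.coeff_map, Polynomial.map_prod, ← e.prod_comp]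
    simp [hw, evalRoots_rename]
  rw [hsum]
  set s := ∑ k, ‖w k‖
  have hs : 0 ≤ s := Finset.sum_nonneg fun _ _ => norm_nonneg _
  have hval : ∀ m : Fin K, ‖MvPolynomial.aeval (Sum.elim b' b'') (P m ^ u m)‖ =
      ‖b'' (Fin.last N)‖ ^ (t m * u m) *
        ‖(∏ k, (Polynomial.X - Polynomial.C (w k))).coeff m‖ ^ u m := by
    intro m
    rw [map_pow, hcoeff, norm_pow, norm_mul, norm_pow, mul_pow, ← pow_mul]
  constructor
  · rcases exists_sum_norm_pow_le_norm_coeff w with h0 | ⟨m, hm, h⟩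
    · rw [show s = 0 from h0, zero_pow (by have := K.factorial_pos; omega), mul_zero]
      exact Finset.sum_nonneg fun _ _ => by positivity
    · have h1 : s ^ L ≤ B * ‖MvPolynomial.aeval (Sum.elim b' b'') (P ⟨m, hm⟩ ^ u ⟨m, hm⟩)‖ := by
        rw [hval]
        set x := ‖(∏ k, (Polynomial.X - Polynomial.C (w k))).coeff m‖ ^ (K.factorial / (K - m))
        have hx : 0 ≤ x := by positivity
        have h2 : 1 ≤ 2 ^ T * ‖b'' (Fin.last N)‖ ^ (t ⟨m, hm⟩ * u ⟨m, hm⟩) := by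
          calc (1 : ℝ) ≤ (2 * ‖b'' (Fin.last N)‖) ^ (t ⟨m, hm⟩ * u ⟨m, hm⟩) :=
                one_le_pow₀ (by linarith)
            _ = 2 ^ (t ⟨m, hm⟩ * u ⟨m, hm⟩) * ‖b'' (Fin.last N)‖ ^ (t ⟨m, hm⟩ * u ⟨m, hm⟩) :=
                mul_pow ..
            _ ≤ _ := by
              gcongr
              · norm_num
              · exact hTm _
        calc s ^ L ≤ ((K : ℝ) ^ 2) ^ L * x := h
          _ ≤ ((K : ℝ) ^ 2) ^ L * x *
              (2 ^ T * ‖b'' (Fin.last N)‖ ^ (t ⟨m, hm⟩ * u ⟨m, hm⟩)) :=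
            le_mul_of_one_le_right (by positivity) h2
          _ = (((K : ℝ) ^ 2) ^ L * 2 ^ T) *
              (‖b'' (Fin.last N)‖ ^ (t ⟨m, hm⟩ * u ⟨m, hm⟩) * x) := by ring
          _ ≤ _ := by
            gcongr
            exact le_add_of_nonneg_right zero_le_one
      have h3 : s ^ (2 * L) ≤
          B ^ 2 * ∑ m, ‖MvPolynomial.aeval (Sum.elim b' b'') (P m ^ u m)‖ ^ 2 := by
        calc s ^ (2 * L) = (s ^ L) ^ 2 := by rw [mul_comm, pow_mul]
          _ ≤ (B * ‖MvPolynomial.aeval (Sum.elim b' b'') (P ⟨m, hm⟩ ^ u ⟨m, hm⟩)‖) ^ 2 := by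
            gcongr
          _ = B ^ 2 * ‖MvPolynomial.aeval (Sum.elim b' b'') (P ⟨m, hm⟩ ^ u ⟨m, hm⟩)‖ ^ 2 :=
            mul_pow ..
          _ ≤ _ := by
            gcongr
            exact Finset.single_le_sum
              (f := fun m => ‖MvPolynomial.aeval (Sum.elim b' b'') (P m ^ u m)‖ ^ 2)
              (fun _ _ => by positivity) (Finset.mem_univ _)
      rwa [inv_mul_le_iff₀ (by positivity)]
  · have h1 : ∀ m : Fin K,
        ‖MvPolynomial.aeval (Sum.elim b' b'') (P m ^ u m)‖ ^ 2 ≤ A ^ 2 * s ^ (2 * L) := by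
      intro m
      have h2 : ‖MvPolynomial.aeval (Sum.elim b' b'') (P m ^ u m)‖ ≤ A * s ^ L := by
        rw [hval, mul_assoc]
        gcongr
        · calc ‖b'' (Fin.last N)‖ ^ (t m * u m) ≤ 2 ^ (t m * u m) := by gcongr
            _ ≤ _ := by
              gcongr
              · norm_num
              · exact hTm _
        · exact norm_coeff_prod_X_sub_C_pow_le w m.2
      calc _ ≤ (A * s ^ L) ^ 2 := by gcongr
        _ = _ := by ring
    refine (Finset.sum_le_card_nsmul _ _ _ fun m _ => h1 m).trans ?_
    rw [Finset.card_univ, Fintype.card_fin, nsmul_eq_mul, ← mul_assoc]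
    gcongr
    exact le_add_of_nonneg_right zero_le_one

end symmetrization

/-! ### Calculus of sums of absolute values of integer polynomials. -/

section normSum

variable {κ : Type*} {N : ℕ}

/-- A function of parameters and roots that is a finite sum of absolute values of integer
polynomials. -/
def IsNormSum (f : (κ → ℂ) → (Fin N → ℂ) → ℝ) : Prop :=
  ∃ (ι : Type) (_ : Fintype ι) (F : ι → MvPolynomial (Fin N) (MvPolynomial κ ℤ)),
    ∀ b α, f b α = ∑ k, ‖evalRoots b α (F k)‖

namespace IsNormSum

lemma norm_evalRoots (F : MvPolynomial (Fin N) (MvPolynomial κ ℤ)) :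
    IsNormSum fun b α => ‖evalRoots b α F‖ :=
  ⟨Unit, inferInstance, fun _ => F, fun b α => by simp⟩

lemma zero : IsNormSum fun (_ : κ → ℂ) (_ : Fin N → ℂ) => 0 :=
  ⟨Empty, inferInstance, Empty.elim, fun b α => by simp⟩

lemma one : IsNormSum fun (_ : κ → ℂ) (_ : Fin N → ℂ) => 1 :=
  ⟨Unit, inferInstance, fun _ => 1, fun b α => by simp⟩

lemma add {f g : (κ → ℂ) → (Fin N → ℂ) → ℝ} (hf : IsNormSum f) (hg : IsNormSum g) :
    IsNormSum fun b α => f b α + g b α := by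
  obtain ⟨ι, _, F, hF⟩ := hf
  obtain ⟨ι', _, G, hG⟩ := hg
  exact ⟨ι ⊕ ι', inferInstance, Sum.elim F G, fun b α => by simp [hF, hG]⟩

lemma mul {f g : (κ → ℂ) → (Fin N → ℂ) → ℝ} (hf : IsNormSum f) (hg : IsNormSum g) :
    IsNormSum fun b α => f b α * g b α := by
  obtain ⟨ι, _, F, hF⟩ := hf
  obtain ⟨ι', _, G, hG⟩ := hg
  refine ⟨ι × ι', inferInstance, fun k => F k.1 * G k.2, fun b α => ?_⟩
  simp only [hF, hG, Finset.sum_mul_sum, Fintype.sum_prod_type, map_mul, norm_mul]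

lemma pow {f : (κ → ℂ) → (Fin N → ℂ) → ℝ} (hf : IsNormSum f) (n : ℕ) :
    IsNormSum fun b α => f b α ^ n := by
  induction n with
  | zero => simpa using one
  | succ n ih => simpa only [pow_succ] using ih.mul hf

lemma sum {ι : Type*} (s : Finset ι) {f : ι → (κ → ℂ) → (Fin N → ℂ) → ℝ}
    (hf : ∀ i ∈ s, IsNormSum (f i)) : IsNormSum fun b α => ∑ i ∈ s, f i b α := by
  classical
  induction s using Finset.induction_on with
  | empty => simpa using zero
  | insert a s ha ih =>
    simp only [Finset.sum_insert ha]
    exact (hf a (by simp)).add (ih fun i hi => hf i (by simp [hi]))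

lemma prod {ι : Type*} (s : Finset ι) {f : ι → (κ → ℂ) → (Fin N → ℂ) → ℝ}
    (hf : ∀ i ∈ s, IsNormSum (f i)) : IsNormSum fun b α => ∏ i ∈ s, f i b α := by
  classical
  induction s using Finset.induction_on with
  | empty => simpa using one
  | insert a s ha ih =>
    simp only [Finset.prod_insert ha]
    exact (hf a (by simp)).mul (ih fun i hi => hf i (by simp [hi]))

/-- Where `f` is invariant under reordering the roots, the symmetrized sum collapses to `N! * f`.
Invariance is required only at the given point, since the numerator of `rootSize` is handled through
a quotient valid for distinct roots. -/
lemma exists_coefficient_family {f : (κ → ℂ) → (Fin N → ℂ) → ℝ} (hf : IsNormSum f) :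
    ∃ (K : ℕ) (P : Fin K → MvPolynomial (κ ⊕ Fin (N + 1)) ℤ) (L : ℕ) (c C : ℝ),
      0 < L ∧ 0 < c ∧ 0 < C ∧
      ∀ (b' : κ → ℂ) (b'' : Fin (N + 1) → ℂ) (α : Fin N → ℂ), HasRoots b'' α →
        1 / 2 ≤ ‖b'' (Fin.last N)‖ → ‖b'' (Fin.last N)‖ ≤ 2 →
        (∀ τ : Equiv.Perm (Fin N), f b' (α ∘ τ) = f b' α) →
        c * f b' α ^ (2 * L) ≤ ∑ m, ‖MvPolynomial.aeval (Sum.elim b' b'') (P m)‖ ^ 2 ∧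
        ∑ m, ‖MvPolynomial.aeval (Sum.elim b' b'') (P m)‖ ^ 2 ≤ C * f b' α ^ (2 * L) := by
  obtain ⟨ι, _, F, hF⟩ := hf
  obtain ⟨K, P, L, c, C, hL, hc, hC, h⟩ := exists_symmetrization F
  have hN : (0 : ℝ) < N.factorial := by exact_mod_cast N.factorial_pos
  refine ⟨K, P, L, c * (N.factorial : ℝ) ^ (2 * L), C * (N.factorial : ℝ) ^ (2 * L), hL,
    by positivity, by positivity, fun b' b'' α hr hlo hhi hsymm => ?_⟩
  have hsum : ∑ τ : Equiv.Perm (Fin N), ∑ k, ‖evalRoots b' (α ∘ τ) (F k)‖ =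
      N.factorial * f b' α := by
    simp only [← hF, hsymm]
    simp [Fintype.card_perm]
  have := h b' b'' α hr hlo hhi
  rw [hsum, mul_pow] at this
  simpa only [mul_assoc] using this

end IsNormSum

end normSum

/-! ### The algebraic size of the integral in terms of the roots. -/

/-- The `ν`-th Taylor coefficient at `a` of the polynomial with coefficients `b`. -/
noncomputable def taylorCoeff {M : ℕ} (b : Fin (M + 1) → ℂ) (a : ℂ) (ν : ℕ) : ℂ :=
  ∑ μ : Fin (M + 1), b μ * (Nat.choose μ ν : ℂ) * a ^ ((μ : ℕ) - ν)

/-- The product `∏ j, (|α i - α l| + |α i - α j|) ^ f` of the root distances at scale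
`|α i - α l|` from `α i`. -/
noncomputable def rootDen {N : ℕ} (f : ℕ) (α : Fin N → ℂ) (p : Fin N × Fin N) : ℝ :=
  ∏ j, (‖α p.1 - α p.2‖ + ‖α p.1 - α j‖) ^ f

/-- The size of `|P| ^ e`, times the `2 D`-th power of the scale, near `α i` at scale
`|α i - α l|`. -/
noncomputable def rootNum {M N : ℕ} (e D : ℕ) (b : Fin (M + 1) → ℂ) (α : Fin N → ℂ)
    (p : Fin N × Fin N) : ℝ :=
  ∑ ν ∈ Finset.range (M + 1), ‖taylorCoeff b (α p.1) ν‖ ^ e *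
    ‖α p.1 - α p.2‖ ^ (ν * e + 2 * D)

/-- The algebraic quantity in the roots that is comparable to the `D`-th power of the integral. -/
noncomputable def rootSize {M N : ℕ} (e f D : ℕ) (b : Fin (M + 1) → ℂ) (α : Fin N → ℂ) : ℝ :=
  (∑ μ, ‖b μ‖) ^ e +
    ∑ p ∈ (Finset.univ : Finset (Fin N)).offDiag, rootNum e D b α p / rootDen f α p

section rootSize

variable {M N : ℕ}

lemma isNormSum_taylorCoeff (i : Fin N) (ν : ℕ) :
    IsNormSum fun (b : Fin (M + 1) → ℂ) (α : Fin N → ℂ) => ‖taylorCoeff b (α i) ν‖ := by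
  convert IsNormSum.norm_evalRoots (∑ μ : Fin (M + 1),
    MvPolynomial.C (MvPolynomial.X μ : MvPolynomial (Fin (M + 1)) ℤ) *
      (Nat.choose μ ν : MvPolynomial (Fin N) (MvPolynomial (Fin (M + 1)) ℤ)) *
      MvPolynomial.X i ^ ((μ : ℕ) - ν)) using 4 with b α
  simp [taylorCoeff, evalRoots_C, evalRoots_X]

lemma isNormSum_norm_sub (i j : Fin N) :
    IsNormSum fun (_ : Fin (M + 1) → ℂ) (α : Fin N → ℂ) => ‖α i - α j‖ := by
  convert IsNormSum.norm_evalRoots (κ := Fin (M + 1)) (MvPolynomial.X i - MvPolynomial.X j)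
    using 4 with b α
  simp [evalRoots_X]

lemma isNormSum_rootDen (f : ℕ) (p : Fin N × Fin N) :
    IsNormSum fun (_ : Fin (M + 1) → ℂ) (α : Fin N → ℂ) => rootDen f α p :=
  IsNormSum.prod _ fun _ _ => ((isNormSum_norm_sub _ _).add (isNormSum_norm_sub _ _)).pow f

lemma isNormSum_rootNum (e D : ℕ) (p : Fin N × Fin N) :
    IsNormSum fun (b : Fin (M + 1) → ℂ) (α : Fin N → ℂ) => rootNum e D b α p :=
  IsNormSum.sum _ fun _ _ => ((isNormSum_taylorCoeff _ _).pow e).mul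
    ((isNormSum_norm_sub _ _).pow _)

/-- The common denominator of `rootSize`. -/
noncomputable def rootDenProd (f : ℕ) (α : Fin N → ℂ) : ℝ :=
  ∏ p ∈ (Finset.univ : Finset (Fin N)).offDiag, rootDen f α p

/-- The numerator of `rootSize` over the common denominator. -/
noncomputable def rootSizeNum (e f D : ℕ) (b : Fin (M + 1) → ℂ) (α : Fin N → ℂ) : ℝ :=
  (∑ μ, ‖b μ‖) ^ e * rootDenProd f α +
    ∑ p ∈ (Finset.univ : Finset (Fin N)).offDiag, rootNum e D b α p *
      ∏ q ∈ (Finset.univ : Finset (Fin N)).offDiag.erase p, rootDen f α q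

lemma isNormSum_rootDenProd (f : ℕ) :
    IsNormSum fun (_ : Fin (M + 1) → ℂ) (α : Fin N → ℂ) => rootDenProd f α :=
  IsNormSum.prod _ fun _ _ => isNormSum_rootDen f _

lemma isNormSum_rootSizeNum (e f D : ℕ) :
    IsNormSum fun (b : Fin (M + 1) → ℂ) (α : Fin N → ℂ) => rootSizeNum e f D b α := by
  refine IsNormSum.add (IsNormSum.mul (IsNormSum.pow (IsNormSum.sum _ fun μ _ => ?_) e)
    (isNormSum_rootDenProd f)) (IsNormSum.sum _ fun p _ => (isNormSum_rootNum e D p).mul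
      (IsNormSum.prod _ fun q _ => isNormSum_rootDen f q))
  convert IsNormSum.norm_evalRoots (N := N)
    (MvPolynomial.C (MvPolynomial.X μ : MvPolynomial (Fin (M + 1)) ℤ)) using 4 with b α
  simp [evalRoots_C]

lemma rootDen_pos (f : ℕ) {α : Fin N → ℂ} (hα : Function.Injective α) {p : Fin N × Fin N}
    (hp : p ∈ (Finset.univ : Finset (Fin N)).offDiag) : 0 < rootDen f α p := by
  have h : p.1 ≠ p.2 := by simpa using hp
  refine Finset.prod_pos fun j _ => pow_pos (add_pos_of_pos_of_nonneg ?_ (norm_nonneg _)) _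
  exact norm_pos_iff.2 (sub_ne_zero.2 (hα.ne h))

lemma rootNum_nonneg (e D : ℕ) (b : Fin (M + 1) → ℂ) (α : Fin N → ℂ) (p : Fin N × Fin N) :
    0 ≤ rootNum e D b α p :=
  Finset.sum_nonneg fun _ _ => by positivity

lemma rootDenProd_pos (f : ℕ) {α : Fin N → ℂ} (hα : Function.Injective α) :
    0 < rootDenProd f α :=
  Finset.prod_pos fun _ hp => rootDen_pos f hα hp

lemma rootSizeNum_eq (e f D : ℕ) (b : Fin (M + 1) → ℂ) {α : Fin N → ℂ}
    (hα : Function.Injective α) :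
    rootSizeNum e f D b α = rootSize e f D b α * rootDenProd f α := by
  rw [rootSizeNum, rootSize, add_mul, Finset.sum_mul]
  congr 1
  refine Finset.sum_congr rfl fun p hp => ?_
  rw [rootDenProd, ← Finset.mul_prod_erase _ _ hp]
  have := (rootDen_pos f hα hp).ne'
  field_simp

lemma rootSize_pos (e f D : ℕ) {b : Fin (M + 1) → ℂ} (hb : b ≠ 0) {α : Fin N → ℂ}
    (hα : Function.Injective α) : 0 < rootSize e f D b α := by
  refine add_pos_of_pos_of_nonneg (pow_pos ?_ _) (Finset.sum_nonneg fun p hp =>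
    div_nonneg (rootNum_nonneg ..) (rootDen_pos f hα hp).le)
  obtain ⟨μ, hμ⟩ := Function.ne_iff.1 hb
  exact Finset.sum_pos' (fun _ _ => norm_nonneg _) ⟨μ, Finset.mem_univ _, norm_pos_iff.2 hμ⟩

lemma rootDen_comp_perm (f : ℕ) (α : Fin N → ℂ) (τ : Equiv.Perm (Fin N)) (p : Fin N × Fin N) :
    rootDen f (α ∘ τ) p = rootDen f α (τ.prodCongr τ p) := by
  simp only [rootDen, Function.comp_apply, Equiv.prodCongr_apply, Prod.map_fst, Prod.map_snd]
  exact Equiv.prod_comp τ fun j => (‖α (τ p.1) - α (τ p.2)‖ + ‖α (τ p.1) - α j‖) ^ f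

lemma rootDenProd_comp_perm (f : ℕ) (α : Fin N → ℂ) (τ : Equiv.Perm (Fin N)) :
    rootDenProd f (α ∘ τ) = rootDenProd f α :=
  Finset.prod_equiv (τ.prodCongr τ) (fun p => by simp) fun p _ => rootDen_comp_perm f α τ p

lemma rootSize_comp_perm (e f D : ℕ) (b : Fin (M + 1) → ℂ) (α : Fin N → ℂ)
    (τ : Equiv.Perm (Fin N)) : rootSize e f D b (α ∘ τ) = rootSize e f D b α := by
  rw [rootSize, rootSize]
  congr 1
  refine Finset.sum_equiv (τ.prodCongr τ) (fun p => by simp) fun p _ => ?_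
  rw [rootDen_comp_perm]
  rfl

end rootSize

/-! ### Construction of the ARP. -/

/-- The exponent is chosen so that `x ^ (2 * L)` becomes `x ^ (1 / D)`; this dictates the rational
exponents of the ARP. -/
lemma rpow_comparison {x u c C : ℝ} {L D : ℕ} (hx : 0 ≤ x) (hL : 0 < L) (hD : 0 < D)
    (hc : 0 < c) (hC : 0 < C) (h₁ : c * x ^ (2 * L) ≤ u) (h₂ : u ≤ C * x ^ (2 * L)) :
    c ^ (((1 / (L * D) : ℚ) : ℝ) / 2) * x ^ (1 / (D : ℝ)) ≤ u ^ (((1 / (L * D) : ℚ) : ℝ) / 2) ∧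
    u ^ (((1 / (L * D) : ℚ) : ℝ) / 2) ≤
      C ^ (((1 / (L * D) : ℚ) : ℝ) / 2) * x ^ (1 / (D : ℝ)) := by
  have hL' : (0 : ℝ) < L := by exact_mod_cast hL
  have hD' : (0 : ℝ) < D := by exact_mod_cast hD
  set q : ℝ := ((1 / (L * D) : ℚ) : ℝ) / 2 with hq
  have hq' : q = 1 / (L * D) / 2 := by rw [hq]; push_cast; rfl
  have hq0 : 0 ≤ q := by rw [hq']; positivity
  have hxq : (x ^ (2 * L)) ^ q = x ^ (1 / (D : ℝ)) := by
    rw [← Real.rpow_natCast, ← Real.rpow_mul hx, hq']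
    congr 1
    push_cast
    field_simp
  have hu : 0 ≤ u := le_trans (by positivity) h₁
  constructor
  · rw [← hxq, ← Real.mul_rpow hc.le (by positivity)]
    exact Real.rpow_le_rpow (by positivity) h₁ hq0
  · rw [← hxq, ← Real.mul_rpow hC.le (by positivity)]
    exact Real.rpow_le_rpow hu h₂ hq0

lemma natDegree_prod_X_sub_C {K : ℕ} (w : Fin K → ℂ) :
    (∏ k, (Polynomial.X - Polynomial.C (w k))).natDegree = K := by
  simp [Polynomial.natDegree_prod_of_monic _ _ fun k _ => Polynomial.monic_X_sub_C (w k)]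

lemma coeff_prod_X_sub_C_card {K : ℕ} (w : Fin K → ℂ) :
    (∏ k, (Polynomial.X - Polynomial.C (w k))).coeff K = 1 := by
  have hmon : (∏ k, (Polynomial.X - Polynomial.C (w k))).Monic :=
    Polynomial.monic_prod_of_monic _ _ fun k _ => Polynomial.monic_X_sub_C _
  rw [Polynomial.Monic, Polynomial.leadingCoeff] at hmon
  simpa only [natDegree_prod_X_sub_C] using hmon

lemma hasRoots_coeff {N : ℕ} (α : Fin N → ℂ) :
    HasRoots (fun k : Fin (N + 1) =>
      (∏ i, (Polynomial.X - Polynomial.C (α i))).coeff k) α := by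
  have h := Polynomial.as_sum_range_C_mul_X_pow (∏ i, (Polynomial.X - Polynomial.C (α i)))
  rw [natDegree_prod_X_sub_C] at h
  rw [HasRoots, Fin.val_last, coeff_prod_X_sub_C_card, map_one, one_mul, polyOfCoeffs]
  conv_rhs => rw [h, Finset.sum_range]

/-- `rootSize` is the quotient of `rootSizeNum` by `rootDenProd`, each of which has its own
coefficient family; the two values of `L` may differ, hence two exponents. -/
lemma exists_arp_comparable_rootSize (M N e f D : ℕ) (hD : 0 < D) :
    ∃ (T : ARP (Fin (M + 1) ⊕ Fin (N + 1)) ℤ) (c C : ℝ), 0 < c ∧ 0 < C ∧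
      ∀ (b' : Fin (M + 1) → ℂ) (b'' : Fin (N + 1) → ℂ) (α : Fin N → ℂ), b' ≠ 0 →
        Function.Injective α → HasRoots b'' α →
        1 / 2 ≤ ‖b'' (Fin.last N)‖ → ‖b'' (Fin.last N)‖ ≤ 2 →
        Sum.elim b' b'' ∈ T.strictDomain ∧
        c * T.eval (Sum.elim b' b'') ≤ rootSize e f D b' α ^ (1 / (D : ℝ)) ∧
        rootSize e f D b' α ^ (1 / (D : ℝ)) ≤ C * T.eval (Sum.elim b' b'') := by
  obtain ⟨K₁, P, L₁, c₁, C₁, hL₁, hc₁, hC₁, h₁⟩ :=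
    (isNormSum_rootSizeNum (M := M) (N := N) e f D).exists_coefficient_family
  obtain ⟨K₂, Q, L₂, c₂, C₂, hL₂, hc₂, hC₂, h₂⟩ :=
    (isNormSum_rootDenProd (M := M) (N := N) f).exists_coefficient_family
  have key : ∀ (b' : Fin (M + 1) → ℂ) (b'' : Fin (N + 1) → ℂ) (α : Fin N → ℂ),
      Function.Injective α → HasRoots b'' α →
      1 / 2 ≤ ‖b'' (Fin.last N)‖ → ‖b'' (Fin.last N)‖ ≤ 2 →
      (c₁ * (rootSize e f D b' α * rootDenProd f α) ^ (2 * L₁) ≤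
          ∑ m, ‖MvPolynomial.aeval (Sum.elim b' b'') (P m)‖ ^ 2 ∧
        ∑ m, ‖MvPolynomial.aeval (Sum.elim b' b'') (P m)‖ ^ 2 ≤
          C₁ * (rootSize e f D b' α * rootDenProd f α) ^ (2 * L₁)) ∧
      (c₂ * rootDenProd f α ^ (2 * L₂) ≤
          ∑ m, ‖MvPolynomial.aeval (Sum.elim b' b'') (Q m)‖ ^ 2 ∧
        ∑ m, ‖MvPolynomial.aeval (Sum.elim b' b'') (Q m)‖ ^ 2 ≤
          C₂ * rootDenProd f α ^ (2 * L₂)) := by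
    intro b' b'' α hα hr hlo hhi
    refine ⟨?_, h₂ b' b'' α hr hlo hhi (rootDenProd_comp_perm f α)⟩
    rw [← rootSizeNum_eq e f D b' hα]
    refine h₁ b' b'' α hr hlo hhi fun τ => ?_
    rw [rootSizeNum_eq e f D b' hα, rootSizeNum_eq e f D b' (hα.comp τ.injective),
      rootSize_comp_perm, rootDenProd_comp_perm]
  have exists_ne : ∀ {K : ℕ} (R : Fin K → MvPolynomial (Fin (M + 1) ⊕ Fin (N + 1)) ℤ)
      (z : Fin (M + 1) ⊕ Fin (N + 1) → ℂ), 0 < ∑ m, ‖MvPolynomial.aeval z (R m)‖ ^ 2 →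
      ∃ m, MvPolynomial.aeval z (R m) ≠ 0 := by
    intro K R z h
    by_contra! hall
    simp [hall] at h
  -- One admissible point suffices: roots `0, …, N - 1`, leading coefficient `1`, and `b'`
  -- constantly `1` make the numerator positive.
  have hne : ∃ m, P m ≠ 0 := by
    let α : Fin N → ℂ := fun i => (i : ℕ)
    have hα : Function.Injective α := fun i j h => Fin.ext (by simpa [α] using h)
    have hb : (fun _ => 1 : Fin (M + 1) → ℂ) ≠ 0 := fun h => by simpa using congrFun h 0
    have hr := hasRoots_coeff α
    have hlead : (∏ i, (Polynomial.X - Polynomial.C (α i))).coeff (Fin.last N) = 1 :=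
      coeff_prod_X_sub_C_card α
    obtain ⟨m, hm⟩ := exists_ne P _ (lt_of_lt_of_le
      (mul_pos hc₁ (pow_pos (mul_pos (rootSize_pos e f D hb hα) (rootDenProd_pos f hα)) _))
      (key (fun _ => 1) _ α hα hr (by simp only [hlead]; norm_num)
        (by simp only [hlead]; norm_num)).1.1)
    exact ⟨m, fun h => hm (by rw [h, map_zero])⟩
  set q₁ : ℝ := ((1 / (L₁ * D) : ℚ) : ℝ) / 2
  set q₂ : ℝ := ((1 / (L₂ * D) : ℚ) : ℝ) / 2
  refine ⟨⟨K₁, K₂, P, Q, 1 / (L₁ * D), 1 / (L₂ * D), by positivity, by positivity, hne⟩,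
    c₂ ^ q₂ / C₁ ^ q₁, C₂ ^ q₂ / c₁ ^ q₁, by positivity, by positivity,
    fun b' b'' α hb hα hr hlo hhi => ?_⟩
  obtain ⟨⟨hP₁, hP₂⟩, hQ₁, hQ₂⟩ := key b' b'' α hα hr hlo hhi
  have hS := rootSize_pos e f D hb hα
  have hW := rootDenProd_pos f hα
  have hSW := mul_pos hS hW
  obtain ⟨hn₁, hn₂⟩ := rpow_comparison hSW.le hL₁ hD hc₁ hC₁ hP₁ hP₂
  obtain ⟨hd₁, hd₂⟩ := rpow_comparison hW.le hL₂ hD hc₂ hC₂ hQ₁ hQ₂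
  have hPpos := lt_of_lt_of_le (mul_pos hc₁ (pow_pos hSW (2 * L₁))) hP₁
  have hQpos := lt_of_lt_of_le (mul_pos hc₂ (pow_pos hW (2 * L₂))) hQ₁
  refine ⟨⟨exists_ne P _ hPpos, exists_ne Q _ hQpos⟩, ?_⟩
  simp only [ARP.eval, ARP.num, ARP.den]
  rw [Real.mul_rpow hS.le hW.le] at hn₁ hn₂
  set n := (∑ m, ‖MvPolynomial.aeval (Sum.elim b' b'') (P m)‖ ^ 2) ^ q₁
  set d := (∑ m, ‖MvPolynomial.aeval (Sum.elim b' b'') (Q m)‖ ^ 2) ^ q₂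
  set x := rootSize e f D b' α ^ (1 / (D : ℝ))
  set y := rootDenProd f α ^ (1 / (D : ℝ))
  have hx : 0 < x := Real.rpow_pos_of_pos hS _
  have hy : 0 < y := Real.rpow_pos_of_pos hW _
  have hd : 0 < d := Real.rpow_pos_of_pos hQpos _
  have hA : 0 < C₁ ^ q₁ := Real.rpow_pos_of_pos hC₁ _
  have hB : 0 < c₁ ^ q₁ := Real.rpow_pos_of_pos hc₁ _
  have hE : 0 < c₂ ^ q₂ := Real.rpow_pos_of_pos hc₂ _
  constructor
  · rw [div_mul_div_comm, div_le_iff₀ (by positivity)]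
    calc c₂ ^ q₂ * n ≤ c₂ ^ q₂ * (C₁ ^ q₁ * (x * y)) := by gcongr
      _ = x * C₁ ^ q₁ * (c₂ ^ q₂ * y) := by ring
      _ ≤ x * C₁ ^ q₁ * d := by gcongr
      _ = _ := by ring
  · rw [div_mul_div_comm, le_div_iff₀ (by positivity)]
    calc x * (c₁ ^ q₁ * d) ≤ x * (c₁ ^ q₁ * (C₂ ^ q₂ * y)) := by gcongr
      _ = C₂ ^ q₂ * (c₁ ^ q₁ * (x * y)) := by ring
      _ ≤ _ := by gcongr

/-! ### Elementary bounds for polynomials. -/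

section measure

open MeasureTheory

section polynomials

variable {M : ℕ}

lemma eval_polyOfCoeffs (b : Fin (M + 1) → ℂ) (z : ℂ) :
    (polyOfCoeffs b).eval z = ∑ μ, b μ * z ^ (μ : ℕ) := by
  simp [polyOfCoeffs, Polynomial.eval_finsetSum]

/-- Binomial expansion; the truncated exponent in `taylorCoeff` is harmless because the binomial
coefficient vanishes for `ν > μ`. -/
lemma eval_add_polyOfCoeffs (b : Fin (M + 1) → ℂ) (a w : ℂ) :
    (polyOfCoeffs b).eval (a + w) =
      (polyOfCoeffs fun ν : Fin (M + 1) => taylorCoeff b a ν).eval w := by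
  rw [eval_polyOfCoeffs, eval_polyOfCoeffs]
  simp only [taylorCoeff, Finset.sum_mul]
  rw [Finset.sum_comm]
  refine Finset.sum_congr rfl fun μ _ => ?_
  rw [Fin.sum_univ_eq_sum_range
    (fun ν => b μ * ((μ : ℕ).choose ν : ℂ) * a ^ ((μ : ℕ) - ν) * w ^ ν), add_comm a w, add_pow,
    Finset.mul_sum]
  refine Finset.sum_subset_zero_on_sdiff (Finset.range_mono (by omega)) (fun ν hν => ?_)
    fun ν _ => by ring
  have : (μ : ℕ) < ν := by simp at hν; omega
  simp [Nat.choose_eq_zero_of_lt this]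

lemma taylorCoeff_zero (b : Fin (M + 1) → ℂ) (ν : Fin (M + 1)) : taylorCoeff b 0 ν = b ν := by
  have h : polyOfCoeffs b = polyOfCoeffs fun ν : Fin (M + 1) => taylorCoeff b 0 ν :=
    Polynomial.funext fun w => by simpa using eval_add_polyOfCoeffs b 0 w
  have := congrArg (fun p => p.coeff ν) h
  simpa only [coeff_polyOfCoeffs] using this.symm

lemma polyOfCoeffs_ne_zero {b : Fin (M + 1) → ℂ} (hb : b ≠ 0) : polyOfCoeffs b ≠ 0 := by
  obtain ⟨μ, hμ⟩ := Function.ne_iff.1 hb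
  intro h
  apply hμ
  rw [← coeff_polyOfCoeffs b μ, h]
  simp

lemma norm_taylorCoeff_le (b : Fin (M + 1) → ℂ) {a : ℂ} (ha : ‖a‖ ≤ 1) (ν : ℕ) :
    ‖taylorCoeff b a ν‖ ≤ 2 ^ M * ∑ μ, ‖b μ‖ := by
  rw [taylorCoeff, Finset.mul_sum]
  refine (norm_sum_le _ _).trans (Finset.sum_le_sum fun μ _ => ?_)
  rw [norm_mul, norm_mul, norm_pow, Complex.norm_natCast]
  have h1 : (((μ : ℕ).choose ν : ℕ) : ℝ) ≤ 2 ^ M := by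
    calc (((μ : ℕ).choose ν : ℕ) : ℝ) ≤ 2 ^ (μ : ℕ) := by
          exact_mod_cast Nat.choose_le_two_pow _ _
      _ ≤ 2 ^ M := pow_le_pow_right₀ (by norm_num) (by omega)
  calc _ ≤ ‖b μ‖ * 2 ^ M * 1 := by
        gcongr
        exact pow_le_one₀ (norm_nonneg _) ha
    _ = _ := by ring

lemma norm_eval_polyOfCoeffs_le (b : Fin (M + 1) → ℂ) {z : ℂ} (hz : ‖z‖ ≤ 1) :
    ‖(polyOfCoeffs b).eval z‖ ≤ ∑ μ, ‖b μ‖ := by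
  rw [eval_polyOfCoeffs]
  refine (norm_sum_le _ _).trans (Finset.sum_le_sum fun μ _ => ?_)
  rw [norm_mul, norm_pow]
  exact mul_le_of_le_one_right (norm_nonneg _) (pow_le_one₀ (norm_nonneg _) hz)

lemma ae_eval_ne_zero {p : Polynomial ℂ} (hp : p ≠ 0) : ∀ᵐ z : ℂ, p.eval z ≠ 0 := by
  have h : {z : ℂ | ¬ p.eval z ≠ 0} ⊆ (p.roots.toFinset : Set ℂ) := fun z hz => by
    simpa [hp] using hz
  exact measure_mono_null h (p.roots.toFinset.finite_toSet.measure_zero _)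

end polynomials

/-- Bounding the sum by the cardinality times its largest term covers `q < 1` and `q ≥ 1` alike. -/
lemma sum_rpow_le {ι : Type*} {s : Finset ι} (hs : s.Nonempty) {x : ι → ℝ}
    (hx : ∀ i ∈ s, 0 ≤ x i) {q : ℝ} (hq : 0 ≤ q) :
    (∑ i ∈ s, x i) ^ q ≤ (s.card : ℝ) ^ q * ∑ i ∈ s, x i ^ q := by
  obtain ⟨k, hk, hmax⟩ := s.exists_max_image x hs
  calc (∑ i ∈ s, x i) ^ q ≤ (s.card * x k) ^ q := by
        refine Real.rpow_le_rpow (Finset.sum_nonneg hx) ?_ hq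
        simpa using Finset.sum_le_card_nsmul _ _ _ hmax
    _ = (s.card : ℝ) ^ q * x k ^ q := Real.mul_rpow (by positivity) (hx k hk)
    _ ≤ _ := by
        gcongr
        exact Finset.single_le_sum (f := fun i => x i ^ q)
          (fun i hi => Real.rpow_nonneg (hx i hi) _) hk

/-! ### Lower bounds for the integral of a power of a polynomial over a disc. -/

section lower

variable {M : ℕ}

lemma continuous_norm_eval_rpow (p : Polynomial ℂ) {ε : ℝ} (hε : 0 ≤ ε) :
    Continuous fun z => ‖p.eval z‖ ^ ε :=
  p.continuous.norm.rpow_const fun _ => Or.inr hε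

lemma setIntegral_norm_eval_rpow_pos {b : Fin (M + 1) → ℂ} (hb : b ≠ 0) {ε : ℝ} (hε : 0 ≤ ε) :
    0 < ∫ z in Metric.closedBall (0 : ℂ) 1, ‖(polyOfCoeffs b).eval z‖ ^ ε := by
  have hcont := continuous_norm_eval_rpow (polyOfCoeffs b) hε
  rw [setIntegral_pos_iff_support_of_nonneg_ae (ae_of_all _ fun z => by positivity)
    (hcont.continuousOn.integrableOn_compact (isCompact_closedBall _ _))]
  have h : (Function.support (fun z => ‖(polyOfCoeffs b).eval z‖ ^ ε) ∩
      Metric.closedBall (0 : ℂ) 1 : Set ℂ) =ᵐ[volume] Metric.closedBall (0 : ℂ) 1 := by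
    filter_upwards [ae_eval_ne_zero (polyOfCoeffs_ne_zero hb)] with z hz
    have h1 : z ∈ Function.support fun z => ‖(polyOfCoeffs b).eval z‖ ^ ε :=
      (Real.rpow_pos_of_pos (norm_pos_iff.2 hz) _).ne'
    exact propext ⟨fun h => h.2, fun h => ⟨h1, h⟩⟩
  rw [measure_congr h]
  exact Metric.measure_closedBall_pos _ _ one_pos

/-- The integral is continuous in `b`, positive on the compact unit sphere, and homogeneous of
degree `ε`. -/
lemma exists_le_setIntegral_closedBall_one (M : ℕ) {ε : ℝ} (hε : 0 ≤ ε) :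
    ∃ c : ℝ, 0 < c ∧ ∀ (b : Fin (M + 1) → ℂ) (ν : Fin (M + 1)),
      c * ‖b ν‖ ^ ε ≤ ∫ z in Metric.closedBall (0 : ℂ) 1, ‖(polyOfCoeffs b).eval z‖ ^ ε := by
  set I : (Fin (M + 1) → ℂ) → ℝ := fun b =>
    ∫ z in Metric.closedBall (0 : ℂ) 1, ‖(polyOfCoeffs b).eval z‖ ^ ε with hI
  have hcont : Continuous I := by
    refine continuous_parametric_integral_of_continuous ?_ (isCompact_closedBall _ _)
    refine Continuous.rpow_const ?_ fun _ => Or.inr hε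
    simp only [eval_polyOfCoeffs]
    fun_prop
  obtain ⟨b₀, hb₀, hmin⟩ := (isCompact_sphere (0 : Fin (M + 1) → ℂ) 1).exists_isMinOn
    (NormedSpace.sphere_nonempty.2 zero_le_one) hcont.continuousOn
  have hb₀' : b₀ ≠ 0 := by
    rintro rfl
    simp at hb₀
  have hV : 0 < volume.real (Metric.closedBall (0 : ℂ) 1) :=
    ENNReal.toReal_pos (Metric.measure_closedBall_pos _ _ one_pos).ne'
      measure_closedBall_lt_top.ne
  -- The volume enters only for `b = 0`, where `0 ^ ε = 1` if `ε = 0`.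
  refine ⟨min (I b₀) (volume.real (Metric.closedBall (0 : ℂ) 1)),
    lt_min (setIntegral_norm_eval_rpow_pos hb₀' hε) hV, fun b ν => ?_⟩
  by_cases hb : b = 0
  · subst hb
    have : (polyOfCoeffs (0 : Fin (M + 1) → ℂ)) = 0 := by simp [polyOfCoeffs]
    simp only [this, Polynomial.eval_zero, norm_zero, Pi.zero_apply, setIntegral_const,
      smul_eq_mul]
    gcongr
    exact min_le_right _ _
  · have hn : 0 < ‖b‖ := norm_pos_iff.2 hb
    set u : Fin (M + 1) → ℂ := (‖b‖⁻¹ : ℂ) • b with hu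
    have hus : u ∈ Metric.sphere (0 : Fin (M + 1) → ℂ) 1 := by
      rw [mem_sphere_zero_iff_norm, hu, norm_smul, norm_inv, Complex.norm_real, norm_norm,
        inv_mul_cancel₀ hn.ne']
    have hbu : b = (‖b‖ : ℂ) • u := by
      rw [hu, smul_smul, mul_inv_cancel₀ (by exact_mod_cast hn.ne'), one_smul]
    have hIb : I b = ‖b‖ ^ ε * I u := by
      simp only [hI]
      rw [← integral_const_mul]
      congr 1
      ext z
      rw [← Real.mul_rpow (norm_nonneg _) (norm_nonneg _)]
      congr 1
      conv_lhs => rw [hbu]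
      simp only [eval_polyOfCoeffs, Pi.smul_apply, smul_eq_mul, mul_assoc, ← Finset.mul_sum]
      rw [norm_mul, Complex.norm_real, norm_norm]
    change _ ≤ I b
    rw [hIb, mul_comm]
    gcongr
    · exact norm_le_pi_norm b ν
    · exact (min_le_left _ _).trans (hmin hus)

lemma setIntegral_closedBall_eq (g : ℂ → ℝ) (a : ℂ) {r : ℝ} (hr : 0 < r) :
    ∫ z in Metric.closedBall a r, g z =
      r ^ 2 * ∫ w in Metric.closedBall (0 : ℂ) 1, g (a + r • w) := by
  have h1 := Measure.setIntegral_comp_smul_of_pos (μ := (volume : Measure ℂ))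
    (fun w => g (a + w)) (Metric.closedBall (0 : ℂ) 1) hr
  have h2 := (measurePreserving_add_left (volume : Measure ℂ) a).setIntegral_preimage_emb
    (measurableEmbedding_addLeft a) g (Metric.closedBall a r)
  rw [h1, Complex.finrank_real_complex, smul_closedBall _ _ zero_le_one, smul_zero, mul_one,
    Real.norm_of_nonneg hr.le, smul_eq_mul, mul_inv_cancel_left₀ (by positivity), ← h2]
  congr 2
  simp [preimage_add_closedBall]

/-- After rescaling to the unit disc the coefficients become `taylorCoeff b a ν * r ^ ν`; the area
factor gives the exponent `2`. -/
lemma exists_le_setIntegral_closedBall (M : ℕ) {ε : ℝ} (hε : 0 ≤ ε) :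
    ∃ c : ℝ, 0 < c ∧ ∀ (b : Fin (M + 1) → ℂ) (a : ℂ) (r : ℝ), 0 < r → ∀ ν : Fin (M + 1),
      c * (‖taylorCoeff b a ν‖ ^ ε * r ^ ((ν : ℕ) * ε + 2)) ≤
        ∫ z in Metric.closedBall a r, ‖(polyOfCoeffs b).eval z‖ ^ ε := by
  obtain ⟨c, hc, h⟩ := exists_le_setIntegral_closedBall_one M hε
  refine ⟨c, hc, fun b a r hr ν => ?_⟩
  rw [setIntegral_closedBall_eq _ _ hr]
  have h1 := h (fun ν => taylorCoeff b a ν * (r : ℂ) ^ (ν : ℕ)) ν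
  have h2 : ∀ w : ℂ, (polyOfCoeffs b).eval (a + r • w) = (polyOfCoeffs fun ν : Fin (M + 1) =>
      taylorCoeff b a ν * (r : ℂ) ^ (ν : ℕ)).eval w := by
    intro w
    rw [eval_add_polyOfCoeffs, eval_polyOfCoeffs, eval_polyOfCoeffs]
    refine Finset.sum_congr rfl fun ν _ => ?_
    rw [Complex.real_smul, mul_pow]
    ring
  simp only [h2]
  calc c * (‖taylorCoeff b a ν‖ ^ ε * r ^ ((ν : ℕ) * ε + 2))
      = r ^ 2 * (c * ‖taylorCoeff b a ν * (r : ℂ) ^ (ν : ℕ)‖ ^ ε) := by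
        rw [norm_mul, norm_pow, Complex.norm_real, Real.norm_of_nonneg hr.le,
          Real.mul_rpow (norm_nonneg _) (by positivity), Real.rpow_add hr, Real.rpow_two,
          Real.rpow_mul hr.le, Real.rpow_natCast]
        ring
    _ ≤ _ := by gcongr

end lower

/-! ### An integrable radial kernel. -/

section kernel

/-- The radial kernel `min (t ^ (η - 2)) (t ^ (-η - 2))`. -/
noncomputable def bumpKernel (η t : ℝ) : ℝ := min (t ^ (η - 2)) (t ^ (-η - 2))

lemma bumpKernel_nonneg (η : ℝ) {t : ℝ} (ht : 0 ≤ t) : 0 ≤ bumpKernel η t :=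
  le_min (Real.rpow_nonneg ht _) (Real.rpow_nonneg ht _)

lemma measurable_bumpKernel (η : ℝ) : Measurable (bumpKernel η) := by
  unfold bumpKernel
  fun_prop

/-- In polar coordinates the integrand is bounded by `y ^ (η - 1)` near `0` and by `y ^ (-η - 1)`
near infinity. -/
lemma integrable_bumpKernel_norm {η : ℝ} (hη : 0 < η) :
    Integrable fun z : ℂ => bumpKernel η ‖z‖ := by
  rw [integrable_fun_norm_addHaar (volume : Measure ℂ), Complex.finrank_real_complex,
    ← Set.Ioc_union_Ioi_eq_Ioi zero_le_one, integrableOn_union]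
  have hm : Measurable fun y : ℝ => y ^ (2 - 1) • bumpKernel η y :=
    (measurable_id.pow_const _).smul (measurable_bumpKernel η)
  have hmul : ∀ {y s : ℝ}, 0 < y → y * y ^ (s - 2) = y ^ (s - 1) := fun {y s} hy => by
    rw [show s - 1 = 1 + (s - 2) by ring, Real.rpow_add hy, Real.rpow_one]
  constructor
  · have h1 : IntegrableOn (fun y : ℝ => y ^ (η - 1)) (Set.Ioc 0 1) :=
      (intervalIntegrable_iff_integrableOn_Ioc_of_le zero_le_one).1
        (intervalIntegral.intervalIntegrable_rpow' (by linarith))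
    refine Integrable.mono' h1 hm.aestronglyMeasurable ?_
    filter_upwards [ae_restrict_mem measurableSet_Ioc] with y hy
    have hy0 : 0 < y := hy.1
    simp only [Nat.add_one_sub_one, pow_one, smul_eq_mul]
    rw [Real.norm_of_nonneg (mul_nonneg hy0.le (bumpKernel_nonneg η hy0.le)), ← hmul hy0]
    gcongr
    exact min_le_left _ _
  · have h1 : IntegrableOn (fun y : ℝ => y ^ (-η - 1)) (Set.Ioi 1) :=
      integrableOn_Ioi_rpow_of_lt (by linarith) one_pos
    refine Integrable.mono' h1 hm.aestronglyMeasurable ?_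
    filter_upwards [ae_restrict_mem measurableSet_Ioi] with y hy
    have hy0 : 0 < y := one_pos.trans hy
    simp only [Nat.add_one_sub_one, pow_one, smul_eq_mul]
    rw [Real.norm_of_nonneg (mul_nonneg hy0.le (bumpKernel_nonneg η hy0.le)), ← hmul hy0]
    gcongr
    exact min_le_right _ _

lemma integrable_scaled_bumpKernel {η : ℝ} (hη : 0 < η) (a : ℂ) {r : ℝ} (hr : 0 < r) :
    Integrable fun z : ℂ => bumpKernel η (‖z - a‖ / r) := by
  have h := ((integrable_bumpKernel_norm hη).comp_smul (inv_ne_zero hr.ne')).comp_sub_right a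
  refine h.congr (ae_of_all _ fun z => ?_)
  simp only [norm_smul, norm_inv, Real.norm_of_nonneg hr.le]
  rw [div_eq_inv_mul]

lemma integral_scaled_bumpKernel (η : ℝ) (a : ℂ) {r : ℝ} (hr : 0 < r) :
    ∫ z : ℂ, bumpKernel η (‖z - a‖ / r) = r ^ 2 * ∫ z : ℂ, bumpKernel η ‖z‖ := by
  have h1 := integral_sub_right_eq_self (μ := (volume : Measure ℂ))
    (fun z : ℂ => bumpKernel η (‖z‖ / r)) a
  have h2 := Measure.integral_comp_smul (volume : Measure ℂ)
    (fun z : ℂ => bumpKernel η ‖z‖) r⁻¹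
  rw [h1]
  simp only [norm_smul, norm_inv, Real.norm_of_nonneg hr.le, Complex.finrank_real_complex] at h2
  simp only [div_eq_inv_mul, h2, smul_eq_mul]
  rw [inv_pow, inv_inv, abs_of_pos (by positivity)]

end kernel

/-! ### Domination by the root distances. -/

section interpolation

variable {N : ℕ}

/-- As long as no distance lies strictly between `r` and `ρ`, the product is a pure power of `r`
times a constant. -/
lemma prod_max_rpow_eq {d : Fin N → ℝ} {ρ r δ : ℝ} (hr : 0 < r)
    (h₁ : ∀ j, d j < ρ → d j ≤ r) (h₂ : ∀ j, ρ ≤ d j → r ≤ d j) :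
    ∏ j, max r (d j) ^ δ = r ^ (((Finset.univ.filter fun j => d j < ρ).card : ℝ) * δ) *
      ∏ j ∈ Finset.univ.filter fun j => ¬ d j < ρ, d j ^ δ := by
  rw [← Finset.prod_filter_mul_prod_filter_not Finset.univ fun j => d j < ρ]
  congr 1
  · rw [Finset.prod_congr rfl (g := fun _ => r ^ δ) fun j hj => by
      rw [max_eq_left (h₁ j (Finset.mem_filter.1 hj).2)], Finset.prod_const, mul_comm,
      Real.rpow_mul hr.le, Real.rpow_natCast]
  · exact Finset.prod_congr rfl fun j hj => by
      rw [max_eq_right (h₂ j (not_lt.1 (Finset.mem_filter.1 hj).2))]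

/-- Around `ρ` the left side is a pure power with exponent `a - 2`, and `|a| ≥ η` makes it decay at
least like the kernel when measured from a suitable endpoint. The choice `l = i` encodes the outer
scale `R`. -/
lemma exists_scale_le {d : Fin N → ℝ} {i : Fin N} (hi : d i = 0) (hd : ∀ j, j ≠ i → 0 < d j)
    {A δ η R ρ : ℝ} (hη : 0 < η) (hA : 0 < A - δ)
    (hgap : ∀ k : ℕ, 1 ≤ k → k ≤ N → η ≤ |A - k * δ|) (hρ : 0 < ρ) (hρR : ρ ≤ R) :
    ∃ l, ρ ^ (A - 2) / ∏ j, max ρ (d j) ^ δ ≤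
      (if l = i then R else d l) ^ (A - 2) / (∏ j, max (if l = i then R else d l) (d j) ^ δ) *
        bumpKernel η (ρ / if l = i then R else d l) := by
  classical
  set s := Finset.univ.filter fun j => d j < ρ with hs
  have his : i ∈ s := by simp [hs, hi, hρ]
  have hk1 : 1 ≤ s.card := Finset.card_pos.2 ⟨i, his⟩
  have hkN : s.card ≤ N := (Finset.card_le_univ s).trans (by simp)
  set a := A - s.card * δ with ha
  have hga := hgap s.card hk1 hkN
  set W := ∏ j ∈ Finset.univ.filter fun j => ¬ d j < ρ, d j ^ δ
  have hW : 0 < W := Finset.prod_pos fun j hj => Real.rpow_pos_of_pos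
    (hρ.trans_le (not_lt.1 (Finset.mem_filter.1 hj).2)) _
  have hform : ∀ r : ℝ, 0 < r → (∀ j, d j < ρ → d j ≤ r) → (∀ j, ρ ≤ d j → r ≤ d j) →
      r ^ (A - 2) / ∏ j, max r (d j) ^ δ = r ^ (a - 2) / W := by
    intro r hr h₁ h₂
    rw [prod_max_rpow_eq hr h₁ h₂, div_mul_eq_div_div, ← Real.rpow_sub hr, ha]
    congr 2
    ring
  have hfin : ∀ r : ℝ, 0 < r → (∀ j, d j < ρ → d j ≤ r) → (∀ j, ρ ≤ d j → r ≤ d j) →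
      (ρ / r) ^ (a - 2) ≤ bumpKernel η (ρ / r) →
      ρ ^ (A - 2) / ∏ j, max ρ (d j) ^ δ ≤
        r ^ (A - 2) / (∏ j, max r (d j) ^ δ) * bumpKernel η (ρ / r) := by
    intro r hr h₁ h₂ h
    rw [hform r hr h₁ h₂, hform ρ hρ (fun j hj => hj.le) (fun j hj => hj)]
    calc ρ ^ (a - 2) / W = r ^ (a - 2) / W * (ρ / r) ^ (a - 2) := by
          rw [Real.div_rpow hρ.le hr.le]
          have := (Real.rpow_pos_of_pos hr (a - 2)).ne'
          field_simp
      _ ≤ _ := by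
          gcongr
  -- For `a ≥ 0` the endpoint is the next distance outward, or `R` if there is none; for `a ≤ 0` it
  -- is the largest distance below `ρ`.
  rcases le_total 0 a with h0 | h0
  · rw [abs_of_nonneg h0] at hga
    have hker : ∀ r : ℝ, 0 < r → ρ ≤ r → (ρ / r) ^ (a - 2) ≤ bumpKernel η (ρ / r) := by
      intro r hr hle
      have ht : 0 < ρ / r := by positivity
      have ht1 : ρ / r ≤ 1 := (div_le_one hr).2 hle
      exact le_min (Real.rpow_le_rpow_of_exponent_ge ht ht1 (by linarith))
        (Real.rpow_le_rpow_of_exponent_ge ht ht1 (by linarith))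
    by_cases hex : ∃ j, ρ ≤ d j
    · obtain ⟨l, hl, hmin⟩ := Finset.exists_min_image (Finset.univ.filter fun j => ρ ≤ d j) d
        (by obtain ⟨j, hj⟩ := hex; exact ⟨j, by simp [hj]⟩)
      have hl : ρ ≤ d l := (Finset.mem_filter.1 hl).2
      have hli : l ≠ i := by
        rintro rfl
        linarith
      refine ⟨l, ?_⟩
      simp only [if_neg hli]
      exact hfin _ (hρ.trans_le hl) (fun j hj => hj.le.trans hl)
        (fun j hj => hmin j (by simp [hj])) (hker _ (hρ.trans_le hl) hl)
    · push Not at hex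
      refine ⟨i, ?_⟩
      simp only [if_true]
      exact hfin R (hρ.trans_le hρR) (fun j hj => hj.le.trans hρR)
        (fun j hj => absurd (hex j) (not_lt.2 hj)) (hker R (hρ.trans_le hρR) hρR)
  · rw [abs_of_nonpos h0] at hga
    -- If only `d i = 0` lay below `ρ`, then `a = A - δ > 0`; so there is a positive distance below
    -- `ρ`.
    have hk2 : 1 < s.card := by
      by_contra hcon
      have : s.card = 1 := by omega
      rw [this] at ha
      simp at ha
      linarith
    obtain ⟨j₁, hj₁, hj₁i⟩ := Finset.exists_mem_ne hk2 i
    obtain ⟨l, hl, hmax⟩ := Finset.exists_max_image s d ⟨i, his⟩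
    have hlpos : 0 < d l := (hd j₁ hj₁i).trans_le (hmax j₁ hj₁)
    have hlρ : d l < ρ := (Finset.mem_filter.1 hl).2
    have hli : l ≠ i := by
      rintro rfl
      linarith
    refine ⟨l, ?_⟩
    simp only [if_neg hli]
    have ht1 : 1 ≤ ρ / d l := (one_le_div hlpos).2 hlρ.le
    exact hfin _ hlpos (fun j hj => hmax j (by simp [hs, hj])) (fun j hj => hlρ.le.trans hj)
      (le_min (Real.rpow_le_rpow_of_exponent_le ht1 (by linarith))
        (Real.rpow_le_rpow_of_exponent_le ht1 (by linarith)))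

end interpolation

/-! ### Local bounds for the integrand and lower bounds for the integral. -/

/-- The function `|P| ^ ε / |Q| ^ δ`. -/
noncomputable def normRatio (ε δ : ℝ) (P Q : Polynomial ℂ) (z : ℂ) : ℝ :=
  ‖P.eval z‖ ^ ε / ‖Q.eval z‖ ^ δ

/-- The size of the integral of `|P| ^ ε / |Q| ^ δ` at scale `r` around `α i` due to the `ν`-th
Taylor coefficient of `P`. -/
noncomputable def scaleTerm {M N : ℕ} (ε δ : ℝ) (b : Fin (M + 1) → ℂ) (α : Fin N → ℂ) (i : Fin N)
    (r : ℝ) (ν : ℕ) : ℝ :=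
  ‖taylorCoeff b (α i) ν‖ ^ ε * (r ^ (ν * ε + 2) / ∏ j, (r + ‖α i - α j‖) ^ δ)

section integral

variable {M N : ℕ} {ε δ : ℝ}

lemma normRatio_nonneg (P Q : Polynomial ℂ) (z : ℂ) : 0 ≤ normRatio ε δ P Q z := by
  unfold normRatio
  positivity

lemma measurable_normRatio (P Q : Polynomial ℂ) : Measurable (normRatio ε δ P Q) :=
  (P.continuous.norm.measurable.pow_const _).div (Q.continuous.norm.measurable.pow_const _)

lemma HasRoots.norm_eval {b : Fin (N + 1) → ℂ} {α : Fin N → ℂ} (h : HasRoots b α) (z : ℂ) :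
    ‖(polyOfCoeffs b).eval z‖ = ‖b (Fin.last N)‖ * ∏ j, ‖z - α j‖ := by
  rw [h, Polynomial.eval_mul, Polynomial.eval_prod, norm_mul, norm_prod]
  simp

lemma le_setIntegral_normRatio (M : ℕ) (hε : 0 ≤ ε) :
    ∃ c : ℝ, 0 < c ∧ ∀ (b : Fin (M + 1) → ℂ) (Q : Polynomial ℂ), Q ≠ 0 →
      IntegrableOn (normRatio ε δ (polyOfCoeffs b) Q) (Metric.ball 0 1) →
      ∀ (a : ℂ) (r V : ℝ), 0 < r → 0 < V → Metric.closedBall a r ⊆ Metric.ball 0 1 →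
      (∀ z ∈ Metric.closedBall a r, ‖Q.eval z‖ ^ δ ≤ V) → ∀ ν : Fin (M + 1),
      c * (‖taylorCoeff b a ν‖ ^ ε * (r ^ ((ν : ℕ) * ε + 2) / V)) ≤
        ∫ z in Metric.ball 0 1, normRatio ε δ (polyOfCoeffs b) Q z := by
  obtain ⟨c, hc, h⟩ := exists_le_setIntegral_closedBall M hε
  refine ⟨c, hc, fun b Q hQ hint a r V hr hV hsub hle ν => ?_⟩
  calc c * (‖taylorCoeff b a ν‖ ^ ε * (r ^ ((ν : ℕ) * ε + 2) / V))
      = c * (‖taylorCoeff b a ν‖ ^ ε * r ^ ((ν : ℕ) * ε + 2)) / V := by ring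
    _ ≤ (∫ z in Metric.closedBall a r, ‖(polyOfCoeffs b).eval z‖ ^ ε) / V := by
        gcongr
        exact h b a r hr ν
    _ = ∫ z in Metric.closedBall a r, ‖(polyOfCoeffs b).eval z‖ ^ ε / V := by
        rw [integral_div]
    _ ≤ ∫ z in Metric.closedBall a r, normRatio ε δ (polyOfCoeffs b) Q z := by
        refine setIntegral_mono_on_ae (Integrable.div_const
          ((continuous_norm_eval_rpow _ hε).continuousOn.integrableOn_compact
            (isCompact_closedBall _ _)) _) (hint.mono_set hsub) measurableSet_closedBall ?_
        -- The zeros of `Q` must be excluded: there division by zero can make the ratio `0`.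
        filter_upwards [ae_eval_ne_zero hQ] with z hz hzr
        have h0 : 0 < ‖Q.eval z‖ ^ δ := Real.rpow_pos_of_pos (norm_pos_iff.2 hz) _
        unfold normRatio
        gcongr
        exact hle z hzr
    _ ≤ _ := setIntegral_mono_set hint (ae_of_all _ fun z => normRatio_nonneg _ _ z)
        hsub.eventuallyLE

/-- Test discs: radius `1/2` about `0` for the coefficients, and radius `|α i - α l| ≤ 1/2` about `α
i` for the scales. Since `|α i| ≤ 1/4`, both stay inside the unit disc. -/
lemma exists_le_setIntegral (M N : ℕ) (hε : 0 ≤ ε) (hδ : 0 ≤ δ) :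
    ∃ c : ℝ, 0 < c ∧ ∀ (b : Fin (M + 1) → ℂ) (b'' : Fin (N + 1) → ℂ) (α : Fin N → ℂ),
      HasRoots b'' α → 1 / 2 ≤ ‖b'' (Fin.last N)‖ → ‖b'' (Fin.last N)‖ ≤ 2 →
      (∀ i, ‖α i‖ ≤ 1 / 4) → Function.Injective α →
      IntegrableOn (normRatio ε δ (polyOfCoeffs b) (polyOfCoeffs b'')) (Metric.ball 0 1) →
      c * (∑ μ, ‖b μ‖) ^ ε ≤
        ∫ z in Metric.ball 0 1, normRatio ε δ (polyOfCoeffs b) (polyOfCoeffs b'') z ∧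
      ∀ i l, i ≠ l → ∀ ν : Fin (M + 1), c * scaleTerm ε δ b α i ‖α i - α l‖ ν ≤
        ∫ z in Metric.ball 0 1, normRatio ε δ (polyOfCoeffs b) (polyOfCoeffs b'') z := by
  obtain ⟨c, hc, h⟩ := le_setIntegral_normRatio (δ := δ) M hε
  set V : ℝ := (2 * 2 ^ N) ^ δ with hVdef
  have hV : 0 < V := by positivity
  set c₀ : ℝ := c * ((1 / 2) ^ (M * ε + 2) / V) / ((M + 1 : ℕ) ^ ε * (M + 1 : ℕ)) with hc₀
  set c₁ : ℝ := c / V with hc₁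
  have hc₀pos : 0 < c₀ := by positivity
  have hc₁pos : 0 < c₁ := by positivity
  refine ⟨min c₀ c₁, lt_min hc₀pos hc₁pos, fun b b'' α hr hlo hhi hα hinj hint => ?_⟩
  have hQ : polyOfCoeffs b'' ≠ 0 := polyOfCoeffs_ne_zero fun h0 => by
    rw [h0] at hlo
    norm_num at hlo
  set I := ∫ z in Metric.ball 0 1, normRatio ε δ (polyOfCoeffs b) (polyOfCoeffs b'') z
  constructor
  · have h1 : ∀ ν : Fin (M + 1), ‖b ν‖ ^ ε ≤ I / (c * ((1 / 2) ^ (M * ε + 2) / V)) := by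
      intro ν
      have h2 := h b _ hQ hint 0 (1 / 2) V (by norm_num) hV
        (Metric.closedBall_subset_ball (by norm_num)) (fun z hz => by
          rw [hr.norm_eval]
          have hz' : ‖z‖ ≤ 1 / 2 := by simpa using hz
          refine Real.rpow_le_rpow (by positivity) ?_ hδ
          gcongr
          refine (Finset.prod_le_prod (g := fun _ => (2 : ℝ)) (fun _ _ => norm_nonneg _)
            fun j _ => ?_).trans (by simp)
          linarith [norm_sub_le z (α j), hα j]) ν
      rw [taylorCoeff_zero] at h2
      rw [le_div_iff₀ (by positivity)]
      refine le_trans ?_ h2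
      have h3 : ((1 : ℝ) / 2) ^ (M * ε + 2) ≤ (1 / 2) ^ ((ν : ℕ) * ε + 2) := by
        refine Real.rpow_le_rpow_of_exponent_ge (by norm_num) (by norm_num) ?_
        have : ((ν : ℕ) : ℝ) ≤ M := by exact_mod_cast Nat.lt_succ_iff.1 ν.2
        gcongr
      calc _ = c * (‖b ν‖ ^ ε * ((1 / 2) ^ (M * ε + 2) / V)) := by ring
        _ ≤ _ := by gcongr
    have h4 := sum_rpow_le (s := Finset.univ) (x := fun ν => ‖b ν‖) Finset.univ_nonempty
      (fun _ _ => norm_nonneg _) hε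
    have h5 := Finset.sum_le_card_nsmul Finset.univ _ _ fun ν _ => h1 ν
    rw [Finset.card_univ, Fintype.card_fin] at h4 h5
    rw [nsmul_eq_mul] at h5
    calc min c₀ c₁ * (∑ μ, ‖b μ‖) ^ ε ≤ c₀ * (((M + 1 : ℕ) : ℝ) ^ ε * (((M + 1 : ℕ) : ℝ) *
          (I / (c * ((1 / 2) ^ (M * ε + 2) / V))))) := by
          gcongr
          · exact min_le_left _ _
          · exact h4.trans (by gcongr)
      _ = I := by
        rw [hc₀]
        have : (0 : ℝ) < (1 / 2) ^ (M * ε + 2) := by positivity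
        have : (0 : ℝ) < ((M + 1 : ℕ) : ℝ) ^ ε := by positivity
        field_simp
  · intro i l hil ν
    set r := ‖α i - α l‖ with hrdef
    have hr0 : 0 < r := norm_pos_iff.2 (sub_ne_zero.2 (hinj.ne hil))
    have hr1 : r ≤ 1 / 2 := (norm_sub_le _ _).trans (by linarith [hα i, hα l])
    have hW : 0 < ∏ j, (r + ‖α i - α j‖) ^ δ := Finset.prod_pos fun j _ => by positivity
    have h2 := h b _ hQ hint (α i) r (V * ∏ j, (r + ‖α i - α j‖) ^ δ) hr0 (by positivity)
      (Metric.closedBall_subset_ball' (by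
        rw [dist_zero_right]
        linarith [hα i])) (fun z hz => by
          rw [hr.norm_eval, Real.finsetProd_rpow _ _ fun j _ => by positivity,
            ← Real.mul_rpow (by positivity) (Finset.prod_nonneg fun j _ => by positivity)]
          refine Real.rpow_le_rpow (by positivity) ?_ hδ
          have hz' : ‖z - α i‖ ≤ r := by simpa [dist_eq_norm] using hz
          calc ‖b'' (Fin.last N)‖ * ∏ j, ‖z - α j‖ ≤ 2 * ∏ j, (r + ‖α i - α j‖) := by
                gcongr with j
                exact (norm_sub_le_norm_sub_add_norm_sub z (α i) (α j)).trans (by gcongr)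
            _ ≤ _ := by
                refine mul_le_mul_of_nonneg_right ?_
                  (Finset.prod_nonneg fun j _ => by positivity)
                linarith [one_le_pow₀ (M₀ := ℝ) (a := 2) (n := N) (by norm_num)]) ν
    refine le_trans ?_ h2
    rw [scaleTerm]
    calc min c₀ c₁ * (‖taylorCoeff b (α i) ν‖ ^ ε *
          (r ^ ((ν : ℕ) * ε + 2) / ∏ j, (r + ‖α i - α j‖) ^ δ))
        ≤ c₁ * (‖taylorCoeff b (α i) ν‖ ^ ε *
          (r ^ ((ν : ℕ) * ε + 2) / ∏ j, (r + ‖α i - α j‖) ^ δ)) := by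
          gcongr
          exact min_le_right _ _
      _ = _ := by
          rw [hc₁]
          field_simp

lemma setIntegral_le_of_le_sum_bumpKernel {ι : Type*} [Fintype ι] {F : ℂ → ℝ} (hF : Measurable F)
    (hF0 : ∀ z, 0 ≤ F z) {η k₀ : ℝ} (hη : 0 < η) {k : ι → ℝ}
    {a : ι → ℂ} {r : ι → ℝ} (hk : ∀ x, 0 ≤ k x) (hr : ∀ x, 0 < r x)
    (h : ∀ᵐ z : ℂ, z ∈ Metric.ball (0 : ℂ) 1 →
      F z ≤ k₀ + ∑ x, k x * bumpKernel η (‖z - a x‖ / r x)) :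
    IntegrableOn F (Metric.ball 0 1) ∧
    ∫ z in Metric.ball 0 1, F z ≤ k₀ * volume.real (Metric.ball (0 : ℂ) 1) +
      (∑ x, k x * r x ^ 2) * ∫ z : ℂ, bumpKernel η ‖z‖ := by
  set G : ℂ → ℝ := fun z => ∑ x, k x * bumpKernel η (‖z - a x‖ / r x)
  have hGint : Integrable G := integrable_finsetSum _ fun x _ =>
    (integrable_scaled_bumpKernel hη (a x) (hr x)).const_mul _
  have hG0 : ∀ z, 0 ≤ G z := fun z => Finset.sum_nonneg fun x _ =>
    mul_nonneg (hk x) (bumpKernel_nonneg _ (div_nonneg (norm_nonneg _) (hr x).le))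
  have hconst : IntegrableOn (fun _ : ℂ => k₀) (Metric.ball 0 1) :=
    integrableOn_const measure_ball_lt_top.ne
  have hdom : IntegrableOn (fun z => k₀ + G z) (Metric.ball 0 1) := hconst.add hGint.integrableOn
  have hae : ∀ᵐ z ∂(volume.restrict (Metric.ball (0 : ℂ) 1)), F z ≤ k₀ + G z :=
    (ae_restrict_iff' measurableSet_ball).2 h
  have hint : IntegrableOn F (Metric.ball 0 1) := by
    refine Integrable.mono' hdom hF.aestronglyMeasurable ?_
    filter_upwards [hae] with z hz
    rwa [Real.norm_of_nonneg (hF0 z)]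
  refine ⟨hint, ?_⟩
  calc ∫ z in Metric.ball 0 1, F z ≤ ∫ z in Metric.ball 0 1, (k₀ + G z) :=
        integral_mono_ae hint hdom hae
    _ = k₀ * volume.real (Metric.ball (0 : ℂ) 1) + ∫ z in Metric.ball 0 1, G z := by
        rw [integral_add hconst hGint.integrableOn, setIntegral_const, smul_eq_mul, mul_comm]
    _ ≤ k₀ * volume.real (Metric.ball (0 : ℂ) 1) + ∫ z, G z :=
        add_le_add le_rfl (setIntegral_le_integral hGint (ae_of_all _ hG0))
    _ = _ := by
        rw [integral_finsetSum _ fun x _ =>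
          (integrable_scaled_bumpKernel hη (a x) (hr x)).const_mul _, Finset.sum_mul]
        simp only [integral_const_mul, integral_scaled_bumpKernel η _ (hr _), mul_assoc]

/-- As `α i` is the nearest root, the triangle inequality gives `|z - α j| ≥ max ρ |α i - α j| / 2`.
The `N` roots and the leading coefficient account for the exponent `N + 1`. -/
lemma normRatio_le_near_root (hε : 0 ≤ ε) (hδ : 0 ≤ δ) {b : Fin (M + 1) → ℂ}
    {b'' : Fin (N + 1) → ℂ} {α : Fin N → ℂ} (hr : HasRoots b'' α)
    (hlo : 1 / 2 ≤ ‖b'' (Fin.last N)‖) {z : ℂ} {i : Fin N} (hz : z ≠ α i)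
    (hi : ∀ j, ‖z - α i‖ ≤ ‖z - α j‖) :
    normRatio ε δ (polyOfCoeffs b) (polyOfCoeffs b'') z ≤
      ((M + 1 : ℕ) : ℝ) ^ ε / ((1 / 2) ^ δ) ^ (N + 1) *
        ∑ ν : Fin (M + 1), ‖taylorCoeff b (α i) ν‖ ^ ε *
          (‖z - α i‖ ^ ((ν : ℕ) * ε) / ∏ j, max ‖z - α i‖ ‖α i - α j‖ ^ δ) := by
  set ρ := ‖z - α i‖ with hρdef
  have hρ : 0 < ρ := norm_pos_iff.2 (sub_ne_zero.2 hz)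
  have hW : 0 < ∏ j, max ρ ‖α i - α j‖ ^ δ := Finset.prod_pos fun j _ =>
    Real.rpow_pos_of_pos (lt_max_of_lt_left hρ) _
  have hnum : ‖(polyOfCoeffs b).eval z‖ ^ ε ≤ ((M + 1 : ℕ) : ℝ) ^ ε *
      ∑ ν : Fin (M + 1), ‖taylorCoeff b (α i) ν‖ ^ ε * ρ ^ ((ν : ℕ) * ε) := by
    have h1 : ‖(polyOfCoeffs b).eval z‖ ≤
        ∑ ν : Fin (M + 1), ‖taylorCoeff b (α i) ν‖ * ρ ^ (ν : ℕ) := by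
      rw [show z = α i + (z - α i) by ring, eval_add_polyOfCoeffs, eval_polyOfCoeffs]
      refine (norm_sum_le _ _).trans (le_of_eq ?_)
      simp [hρdef]
    refine (Real.rpow_le_rpow (norm_nonneg _) h1 hε).trans ?_
    refine (sum_rpow_le Finset.univ_nonempty (fun _ _ => by positivity) hε).trans (le_of_eq ?_)
    rw [Finset.card_univ, Fintype.card_fin]
    congr 1
    refine Finset.sum_congr rfl fun ν _ => ?_
    rw [Real.mul_rpow (norm_nonneg _) (by positivity), Real.rpow_mul hρ.le, Real.rpow_natCast]
  have hden : ((1 / 2 : ℝ) ^ δ) ^ (N + 1) * ∏ j, max ρ ‖α i - α j‖ ^ δ ≤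
      ‖(polyOfCoeffs b'').eval z‖ ^ δ := by
    have h1 : (1 / 2 : ℝ) ^ (N + 1) * ∏ j, max ρ ‖α i - α j‖ ≤
        ‖(polyOfCoeffs b'').eval z‖ := by
      calc (1 / 2 : ℝ) ^ (N + 1) * ∏ j, max ρ ‖α i - α j‖
          = 1 / 2 * ∏ j, (1 / 2 * max ρ ‖α i - α j‖) := by
            rw [Finset.prod_mul_distrib, Finset.prod_const, Finset.card_univ, Fintype.card_fin]
            ring
        _ ≤ _ := by
            rw [hr.norm_eval]
            gcongr with j
            have h2 := hi j
            have h3 : ‖α i - α j‖ ≤ ρ + ‖z - α j‖ := by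
              rw [hρdef, norm_sub_rev z (α i)]
              exact norm_sub_le_norm_sub_add_norm_sub (α i) z (α j)
            rw [one_div, inv_mul_le_iff₀ two_pos]
            exact max_le (by linarith) (by linarith)
    calc _ = ((1 / 2 : ℝ) ^ (N + 1) * ∏ j, max ρ ‖α i - α j‖) ^ δ := by
          rw [Real.mul_rpow (by positivity) (Finset.prod_nonneg fun j _ => by positivity),
            Real.finsetProd_rpow _ _ fun j _ => by positivity, ← Real.rpow_natCast,
            ← Real.rpow_natCast, ← Real.rpow_mul (by positivity), ← Real.rpow_mul (by positivity),
            mul_comm δ]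
      _ ≤ _ := Real.rpow_le_rpow
          (mul_nonneg (by positivity) (Finset.prod_nonneg fun j _ => by positivity)) h1 hδ
  unfold normRatio
  calc _ ≤ (((M + 1 : ℕ) : ℝ) ^ ε *
        ∑ ν : Fin (M + 1), ‖taylorCoeff b (α i) ν‖ ^ ε * ρ ^ ((ν : ℕ) * ε)) /
        (((1 / 2 : ℝ) ^ δ) ^ (N + 1) * ∏ j, max ρ ‖α i - α j‖ ^ δ) := by
        gcongr
    _ = _ := by
        rw [mul_div_mul_comm, Finset.sum_div]
        simp only [mul_div_assoc]

lemma scale_bound (hδ : 0 ≤ δ) (b : Fin (M + 1) → ℂ) (α : Fin N → ℂ) (i : Fin N) {r : ℝ}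
    (hr : 0 < r) (ν : ℕ) :
    ‖taylorCoeff b (α i) ν‖ ^ ε * (r ^ (ν * ε) / ∏ j, max r ‖α i - α j‖ ^ δ) * r ^ 2 ≤
      (2 ^ δ) ^ N * scaleTerm ε δ b α i r ν := by
  have hW : 0 < ∏ j, max r ‖α i - α j‖ ^ δ := Finset.prod_pos fun j _ =>
    Real.rpow_pos_of_pos (lt_max_of_lt_left hr) _
  have hW' : 0 < ∏ j, (r + ‖α i - α j‖) ^ δ := Finset.prod_pos fun j _ => by positivity
  have h : ∏ j, (r + ‖α i - α j‖) ^ δ ≤ ((2 : ℝ) ^ δ) ^ N * ∏ j, max r ‖α i - α j‖ ^ δ := by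
    calc ∏ j, (r + ‖α i - α j‖) ^ δ ≤ ∏ j, ((2 : ℝ) ^ δ * max r ‖α i - α j‖ ^ δ) := by
          gcongr with j
          rw [← Real.mul_rpow two_pos.le (by positivity)]
          refine Real.rpow_le_rpow (by positivity) ?_ hδ
          linarith [le_max_left r ‖α i - α j‖, le_max_right r ‖α i - α j‖]
      _ = _ := by
          rw [Finset.prod_mul_distrib, Finset.prod_const, Finset.card_univ, Fintype.card_fin]
  rw [scaleTerm, Real.rpow_add hr, Real.rpow_two]
  have key : (1 : ℝ) / ∏ j, max r ‖α i - α j‖ ^ δ ≤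
      (2 ^ δ) ^ N * (1 / ∏ j, (r + ‖α i - α j‖) ^ δ) := by
    rw [mul_one_div, div_le_div_iff₀ hW hW', one_mul]
    exact h
  calc _ = ‖taylorCoeff b (α i) ν‖ ^ ε * (r ^ (ν * ε) * r ^ 2) *
        (1 / ∏ j, max r ‖α i - α j‖ ^ δ) := by ring
    _ ≤ ‖taylorCoeff b (α i) ν‖ ^ ε * (r ^ (ν * ε) * r ^ 2) *
        ((2 ^ δ) ^ N * (1 / ∏ j, (r + ‖α i - α j‖) ^ δ)) := by gcongr
    _ = _ := by ring

end integral

lemma exists_pos_le_of_forall_pos {ι : Type*} (s : Finset ι) {f : ι → ℝ} (hf : ∀ x ∈ s, 0 < f x) :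
    ∃ η : ℝ, 0 < η ∧ ∀ x ∈ s, η ≤ f x := by
  rcases s.eq_empty_or_nonempty with rfl | hs
  · exact ⟨1, one_pos, by simp⟩
  · obtain ⟨x, hx, hmin⟩ := s.exists_min_image f hs
    exact ⟨f x, hf x hx, hmin⟩

/-- Finitely many nonzero numbers are bounded away from `0`. Here `k` replaces the `N - k` of
`Nondegenerate`. -/
lemma Nondegenerate.exists_gap {M N : ℕ} {ε δ : ℚ} (h : Nondegenerate M N ε δ) :
    ∃ η : ℝ, 0 < η ∧ ∀ ν k : ℕ, ν ≤ M → 1 ≤ k → k ≤ N →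
      η ≤ |(ν * (ε : ℝ) + 2) - k * (δ : ℝ)| := by
  obtain ⟨η, hη, hle⟩ := exists_pos_le_of_forall_pos (Finset.range (M + 1) ×ˢ Finset.Icc 1 N)
    (f := fun x => |(x.1 * (ε : ℝ) + 2) - x.2 * (δ : ℝ)|) (by
      rintro ⟨ν, k⟩ hx
      simp only [Finset.mem_product, Finset.mem_range, Finset.mem_Icc] at hx
      obtain ⟨hν, hk1, hkN⟩ := hx
      have h1 := h ν (N - k) (by omega) (by omega)
      rw [Nat.cast_sub hkN] at h1
      refine abs_pos.2 fun h0 => h1 ?_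
      have h2 : (ν : ℚ) * ε + 2 - k * δ = 0 := by exact_mod_cast h0
      linear_combination h2)
  refine ⟨η, hη, fun ν k hν hk1 hkN => hle (ν, k) ?_⟩
  simp only [Finset.mem_product, Finset.mem_range, Finset.mem_Icc]
  omega

/-! ### Upper bound for the integral. -/

section upper

variable {M N : ℕ} {ε δ : ℝ}

/-- The sum over the scales `|α i - α l|` that governs the integral of `|P| ^ ε / |Q| ^ δ`. -/
noncomputable def scaleSum (ε δ : ℝ) (b : Fin (M + 1) → ℂ) (α : Fin N → ℂ) : ℝ :=
  (∑ μ, ‖b μ‖) ^ ε + ∑ p ∈ (Finset.univ : Finset (Fin N)).offDiag,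
    ∑ ν : Fin (M + 1), scaleTerm ε δ b α p.1 ‖α p.1 - α p.2‖ ν

lemma scaleTerm_nonneg (b : Fin (M + 1) → ℂ) (α : Fin N → ℂ) (i : Fin N) {r : ℝ} (hr : 0 ≤ r)
    (ν : ℕ) : 0 ≤ scaleTerm ε δ b α i r ν :=
  mul_nonneg (by positivity) (div_nonneg (by positivity)
    (Finset.prod_nonneg fun j _ => by positivity))

lemma rpow_sum_norm_le_scaleSum (b : Fin (M + 1) → ℂ) (α : Fin N → ℂ) :
    (∑ μ, ‖b μ‖) ^ ε ≤ scaleSum ε δ b α :=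
  le_add_of_nonneg_right (Finset.sum_nonneg fun _ _ => Finset.sum_nonneg fun _ _ =>
    scaleTerm_nonneg _ _ _ (norm_nonneg _) _)

lemma scaleTerm_le_scaleSum (b : Fin (M + 1) → ℂ) (α : Fin N → ℂ) {i l : Fin N} (h : i ≠ l)
    (ν : Fin (M + 1)) : scaleTerm ε δ b α i ‖α i - α l‖ ν ≤ scaleSum ε δ b α := by
  have h1 : scaleTerm ε δ b α i ‖α i - α l‖ ν ≤
      ∑ ν : Fin (M + 1), scaleTerm ε δ b α i ‖α i - α l‖ ν :=
    Finset.single_le_sum (f := fun ν : Fin (M + 1) => scaleTerm ε δ b α i ‖α i - α l‖ ν)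
      (fun _ _ => scaleTerm_nonneg _ _ _ (norm_nonneg _) _) (Finset.mem_univ ν)
  have h2 := Finset.single_le_sum (s := (Finset.univ : Finset (Fin N)).offDiag)
    (f := fun p => ∑ ν : Fin (M + 1), scaleTerm ε δ b α p.1 ‖α p.1 - α p.2‖ ν)
    (fun _ _ => Finset.sum_nonneg fun _ _ => scaleTerm_nonneg _ _ _ (norm_nonneg _) _)
    (a := (i, l)) (by simpa using h)
  exact (h1.trans h2).trans (le_add_of_nonneg_left (by positivity))

/-- The outer scale `2` contributes nothing beyond the coefficient term of `scaleSum`. -/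
lemma scaleTerm_two_le (hε : 0 ≤ ε) (hδ : 0 ≤ δ) (b : Fin (M + 1) → ℂ) {α : Fin N → ℂ}
    (hα : ∀ i, ‖α i‖ ≤ 1 / 4) (i : Fin N) (ν : Fin (M + 1)) :
    scaleTerm ε δ b α i 2 ν ≤ (2 ^ M) ^ ε * 2 ^ (M * ε + 2) * (∑ μ, ‖b μ‖) ^ ε := by
  have hν : ((ν : ℕ) : ℝ) ≤ M := by exact_mod_cast Nat.lt_succ_iff.1 ν.2
  have h1 : ‖taylorCoeff b (α i) ν‖ ^ ε ≤ (2 ^ M) ^ ε * (∑ μ, ‖b μ‖) ^ ε := by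
    rw [← Real.mul_rpow (by positivity) (by positivity)]
    exact Real.rpow_le_rpow (norm_nonneg _)
      (norm_taylorCoeff_le b ((hα i).trans (by norm_num)) _) hε
  have h2 : (1 : ℝ) ≤ ∏ j, (2 + ‖α i - α j‖) ^ δ := by
    have := Finset.prod_le_prod (s := Finset.univ) (f := fun _ : Fin N => (1 : ℝ))
      (g := fun j => (2 + ‖α i - α j‖) ^ δ) (fun _ _ => zero_le_one)
      fun j _ => Real.one_le_rpow (by linarith [norm_nonneg (α i - α j)]) hδ
    simpa using this
  have h3 : (2 : ℝ) ^ ((ν : ℕ) * ε + 2) ≤ 2 ^ (M * ε + 2) := by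
    refine Real.rpow_le_rpow_of_exponent_le (by norm_num) ?_
    gcongr
  calc scaleTerm ε δ b α i 2 ν
      ≤ ((2 ^ M) ^ ε * (∑ μ, ‖b μ‖) ^ ε) * (2 ^ (M * ε + 2) / 1) := by
        unfold scaleTerm
        gcongr
    _ = _ := by ring

lemma exists_setIntegral_le (M N : ℕ) {η : ℝ} (hε : 0 ≤ ε) (hδ : 0 ≤ δ) (hδ2 : δ < 2) (hη : 0 < η)
    (hgap : ∀ ν k : ℕ, ν ≤ M → 1 ≤ k → k ≤ N → η ≤ |(ν * ε + 2) - k * δ|) :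
    ∃ C : ℝ, 0 < C ∧ ∀ (b : Fin (M + 1) → ℂ) (b'' : Fin (N + 1) → ℂ) (α : Fin N → ℂ),
      HasRoots b'' α → 1 / 2 ≤ ‖b'' (Fin.last N)‖ → (∀ i, ‖α i‖ ≤ 1 / 4) →
      Function.Injective α →
      IntegrableOn (normRatio ε δ (polyOfCoeffs b) (polyOfCoeffs b'')) (Metric.ball 0 1) ∧
      ∫ z in Metric.ball 0 1, normRatio ε δ (polyOfCoeffs b) (polyOfCoeffs b'') z ≤
        C * scaleSum ε δ b α := by
  set C₁ : ℝ := ((M + 1 : ℕ) : ℝ) ^ ε / ((1 / 2) ^ δ) ^ (N + 1) with hC₁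
  set C₂ : ℝ := (2 ^ δ) ^ N * (1 + (2 ^ M) ^ ε * 2 ^ (M * ε + 2)) with hC₂
  set n : ℝ := ((Fintype.card (Fin N × Fin N × Fin (M + 1)) : ℕ) : ℝ)
  set Φ : ℝ := ∫ z : ℂ, bumpKernel η ‖z‖
  set v : ℝ := volume.real (Metric.ball (0 : ℂ) 1)
  have hΦ : 0 ≤ Φ := integral_nonneg fun z => bumpKernel_nonneg _ (norm_nonneg _)
  have hv : 0 ≤ v := measureReal_nonneg
  have hC₁pos : 0 < C₁ := by positivity
  have hC₂pos : 0 < C₂ := by positivity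
  refine ⟨2 ^ δ * v + n * (C₁ * C₂) * Φ + 1, by positivity,
    fun b b'' α hr hlo hα hinj => ?_⟩
  -- The diagonal `l = i` carries the outer scale; `2` exceeds the distance from any root to any
  -- point of the unit disc.
  set R : Fin N × Fin N × Fin (M + 1) → ℝ :=
    fun x => if x.2.1 = x.1 then 2 else ‖α x.1 - α x.2.1‖ with hR
  have hRpos : ∀ x, 0 < R x := by
    intro x
    simp only [hR]
    split_ifs with h
    · exact two_pos
    · exact norm_pos_iff.2 (sub_ne_zero.2 (hinj.ne (Ne.symm h)))
  set k : Fin N × Fin N × Fin (M + 1) → ℝ := fun x =>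
    C₁ * (‖taylorCoeff b (α x.1) x.2.2‖ ^ ε *
      (R x ^ ((x.2.2 : ℕ) * ε) / ∏ j, max (R x) ‖α x.1 - α j‖ ^ δ)) with hk
  have hk0 : ∀ x, 0 ≤ k x := fun x => mul_nonneg hC₁pos.le (mul_nonneg (by positivity)
    (div_nonneg (Real.rpow_nonneg (hRpos x).le _) (Finset.prod_nonneg fun j _ => by positivity)))
  set S := scaleSum ε δ b α
  have hA : (∑ μ, ‖b μ‖) ^ ε ≤ S := rpow_sum_norm_le_scaleSum b α
  have hS : 0 ≤ S := le_trans (by positivity) hA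
  have hkR : ∀ x, k x * R x ^ 2 ≤ C₁ * C₂ * S := by
    rintro ⟨i, l, ν⟩
    have h1 := scale_bound (ε := ε) hδ b α i (hRpos (i, l, ν)) ν
    have h2 : scaleTerm ε δ b α i (R (i, l, ν)) ν ≤ (1 + (2 ^ M) ^ ε * 2 ^ (M * ε + 2)) * S := by
      by_cases hli : l = i
      · simp only [hR, if_pos hli]
        refine (scaleTerm_two_le hε hδ b hα i ν).trans ?_
        gcongr
        exact le_add_of_nonneg_left zero_le_one
      · simp only [hR, if_neg hli]
        refine (scaleTerm_le_scaleSum b α (Ne.symm hli) ν).trans ?_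
        exact le_mul_of_one_le_left hS (le_add_of_nonneg_right (by positivity))
    calc k (i, l, ν) * R (i, l, ν) ^ 2 = C₁ * (‖taylorCoeff b (α i) ν‖ ^ ε *
          (R (i, l, ν) ^ ((ν : ℕ) * ε) / ∏ j, max (R (i, l, ν)) ‖α i - α j‖ ^ δ) *
            R (i, l, ν) ^ 2) := by simp only [hk]; ring
      _ ≤ C₁ * ((2 ^ δ) ^ N * ((1 + (2 ^ M) ^ ε * 2 ^ (M * ε + 2)) * S)) := by
          refine mul_le_mul_of_nonneg_left ?_ hC₁pos.le
          exact h1.trans (mul_le_mul_of_nonneg_left h2 (by positivity))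
      _ = _ := by rw [hC₂]; ring
  obtain ⟨hint, hle⟩ := setIntegral_le_of_le_sum_bumpKernel
    (F := normRatio ε δ (polyOfCoeffs b) (polyOfCoeffs b'')) (measurable_normRatio _ _)
    (normRatio_nonneg _ _) (k₀ := 2 ^ δ * (∑ μ, ‖b μ‖) ^ ε) hη (k := k)
    (a := fun x => α x.1) hk0 hRpos (by
      have hae : ∀ᵐ z : ℂ, z ∉ Set.range α :=
        measure_eq_zero_iff_ae_notMem.1 ((Set.finite_range α).measure_zero _)
      filter_upwards [hae] with z hz hz1
      have hz1' : ‖z‖ < 1 := by simpa using hz1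
      have hsum0 : 0 ≤ ∑ x, k x * bumpKernel η (‖z - α x.1‖ / R x) :=
        Finset.sum_nonneg fun x _ => mul_nonneg (hk0 x)
          (bumpKernel_nonneg _ (div_nonneg (norm_nonneg _) (hRpos x).le))
      rcases isEmpty_or_nonempty (Fin N) with hN | hN
      -- Without roots `Q` is a constant of modulus at least `1/2`; only this case uses the constant
      -- term `k₀`.
      · refine le_add_of_le_of_nonneg ?_ hsum0
        have h1 : 1 / 2 ≤ ‖(polyOfCoeffs b'').eval z‖ := by
          rw [hr.norm_eval]
          simpa using hlo
        have h2 : (1 / 2 : ℝ) ^ δ ≤ ‖(polyOfCoeffs b'').eval z‖ ^ δ :=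
          Real.rpow_le_rpow (by norm_num) h1 hδ
        unfold normRatio
        calc _ ≤ (∑ μ, ‖b μ‖) ^ ε / (1 / 2 : ℝ) ^ δ := by
              gcongr
              exact norm_eval_polyOfCoeffs_le b hz1'.le
          _ = _ := by
              rw [Real.div_rpow zero_le_one two_pos.le, Real.one_rpow]
              field_simp
      · refine le_add_of_nonneg_of_le (by positivity) ?_
        obtain ⟨i, -, hi⟩ := Finset.exists_min_image Finset.univ (fun j => ‖z - α j‖)
          Finset.univ_nonempty
        have hzi : z ≠ α i := fun h => hz ⟨i, h.symm⟩
        have hρ : 0 < ‖z - α i‖ := norm_pos_iff.2 (sub_ne_zero.2 hzi)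
        have hρ2 : ‖z - α i‖ ≤ 2 := (norm_sub_le _ _).trans (by linarith [hα i])
        refine (normRatio_le_near_root hε hδ hr hlo hzi fun j => hi j (Finset.mem_univ j)).trans ?_
        rw [Fintype.sum_prod_type]
        refine le_trans ?_ (Finset.single_le_sum (f := fun i => ∑ y : Fin N × Fin (M + 1),
          k (i, y) * bumpKernel η (‖z - α i‖ / R (i, y))) (fun i _ => Finset.sum_nonneg fun y _ =>
            mul_nonneg (hk0 _) (bumpKernel_nonneg _ (div_nonneg (norm_nonneg _) (hRpos _).le)))
          (Finset.mem_univ i))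
        rw [Fintype.sum_prod_type_right, Finset.mul_sum]
        refine Finset.sum_le_sum fun ν _ => ?_
        obtain ⟨l, hl⟩ := exists_scale_le (d := fun j => ‖α i - α j‖) (i := i)
          (A := (ν : ℕ) * ε + 2) (δ := δ) (R := 2) (ρ := ‖z - α i‖) (by simp)
          (fun j hj => norm_pos_iff.2 (sub_ne_zero.2 (hinj.ne (Ne.symm hj)))) hη
          (by have : 0 ≤ ((ν : ℕ) : ℝ) * ε := by positivity
              linarith) (fun k hk1 hkN => hgap ν k (Nat.lt_succ_iff.1 ν.2) hk1 hkN) hρ hρ2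
        rw [add_sub_cancel_right] at hl
        refine le_trans ?_ (Finset.single_le_sum (f := fun l =>
          k (i, l, ν) * bumpKernel η (‖z - α i‖ / R (i, l, ν))) (fun l _ =>
            mul_nonneg (hk0 _) (bumpKernel_nonneg _ (div_nonneg (norm_nonneg _) (hRpos _).le)))
          (Finset.mem_univ l))
        simp only [hk, hR]
        rw [mul_assoc C₁, mul_assoc (‖taylorCoeff b (α i) ν‖ ^ ε)]
        gcongr)
  refine ⟨hint, hle.trans ?_⟩
  have hsum : ∑ x, k x * R x ^ 2 ≤ n * (C₁ * C₂ * S) := by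
    refine (Finset.sum_le_card_nsmul _ _ _ fun x _ => hkR x).trans (le_of_eq ?_)
    rw [nsmul_eq_mul, Finset.card_univ]
  calc _ ≤ 2 ^ δ * S * v + n * (C₁ * C₂ * S) * Φ := by gcongr
    _ ≤ 2 ^ δ * S * v + n * (C₁ * C₂ * S) * Φ + S := le_add_of_nonneg_right hS
    _ = _ := by ring

end upper

/-! ### Comparison of the scale sum with `rootSize`. -/

section comparison

variable {M N : ℕ}

lemma pow_rpow_one_div {x : ℝ} (hx : 0 ≤ x) (e D : ℕ) :
    (x ^ e) ^ (1 / (D : ℝ)) = x ^ ((e : ℝ) / D) := by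
  rw [← Real.rpow_natCast, ← Real.rpow_mul hx]
  congr 1
  ring

lemma scaleTerm_eq_rpow {e f D : ℕ} (hD : 0 < D) (b : Fin (M + 1) → ℂ) (α : Fin N → ℂ)
    (p : Fin N × Fin N) (ν : ℕ) :
    scaleTerm ((e : ℝ) / D) ((f : ℝ) / D) b α p.1 ‖α p.1 - α p.2‖ ν =
      (‖taylorCoeff b (α p.1) ν‖ ^ e * ‖α p.1 - α p.2‖ ^ (ν * e + 2 * D) / rootDen f α p) ^
        (1 / (D : ℝ)) := by
  have hD' : (D : ℝ) ≠ 0 := by positivity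
  have hden : 0 ≤ rootDen f α p := Finset.prod_nonneg fun j _ => by positivity
  rw [Real.div_rpow (by positivity) hden, Real.mul_rpow (by positivity) (by positivity),
    pow_rpow_one_div (norm_nonneg _), pow_rpow_one_div (norm_nonneg _), rootDen,
    ← Real.finsetProd_rpow _ _ fun j _ => by positivity, scaleTerm, mul_div_assoc]
  congr 2
  · congr 1
    push_cast
    field_simp
  · exact Finset.prod_congr rfl fun j _ => (pow_rpow_one_div (by positivity) f D).symm

lemma scaleSum_le_rootSize {e f D : ℕ} (hD : 0 < D) (b : Fin (M + 1) → ℂ) {α : Fin N → ℂ}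
    (hα : Function.Injective α) :
    scaleSum ((e : ℝ) / D) ((f : ℝ) / D) b α ≤
      (1 + ((Finset.univ : Finset (Fin N)).offDiag.card : ℝ) * (M + 1 : ℕ)) *
        rootSize e f D b α ^ (1 / (D : ℝ)) := by
  have hq : (0 : ℝ) ≤ 1 / (D : ℝ) := by positivity
  have hquot : ∀ p ∈ (Finset.univ : Finset (Fin N)).offDiag,
      0 ≤ rootNum e D b α p / rootDen f α p := fun p hp =>
    div_nonneg (rootNum_nonneg ..) (rootDen_pos f hα hp).le
  rw [scaleSum, add_mul, one_mul]
  gcongr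
  · rw [← pow_rpow_one_div (by positivity)]
    exact Real.rpow_le_rpow (by positivity) (le_add_of_nonneg_right (Finset.sum_nonneg hquot)) hq
  · rw [mul_assoc, ← nsmul_eq_mul]
    refine Finset.sum_le_card_nsmul _ _ _ fun p hp => ?_
    have hden := rootDen_pos f hα hp
    refine (Finset.sum_le_card_nsmul _ _ (rootSize e f D b α ^ (1 / (D : ℝ))) fun ν _ => ?_).trans
      (le_of_eq (by rw [nsmul_eq_mul, Finset.card_univ, Fintype.card_fin]))
    rw [scaleTerm_eq_rpow hD]
    refine Real.rpow_le_rpow (by positivity) ?_ hq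
    calc _ ≤ rootNum e D b α p / rootDen f α p := by
          gcongr
          exact Finset.single_le_sum (f := fun ν => ‖taylorCoeff b (α p.1) ν‖ ^ e *
            ‖α p.1 - α p.2‖ ^ (ν * e + 2 * D)) (fun _ _ => by positivity)
            (Finset.mem_range.2 ν.2)
      _ ≤ ∑ p ∈ (Finset.univ : Finset (Fin N)).offDiag, rootNum e D b α p / rootDen f α p :=
          Finset.single_le_sum (f := fun p => rootNum e D b α p / rootDen f α p) hquot hp
      _ ≤ _ := le_add_of_nonneg_left (by positivity)

/-- Every summand of the expanded `rootSize` has its `D`-th root at most `I`, so the sum is at most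
the number of summands times `I ^ D`. -/
lemma rootSize_le_of_scaleTerm_le {e f D : ℕ} (hD : 0 < D) (b : Fin (M + 1) → ℂ) {α : Fin N → ℂ}
    (hα : Function.Injective α) {I : ℝ} (h₀ : (∑ μ, ‖b μ‖) ^ ((e : ℝ) / D) ≤ I)
    (h₁ : ∀ i l, i ≠ l → ∀ ν : Fin (M + 1),
      scaleTerm ((e : ℝ) / D) ((f : ℝ) / D) b α i ‖α i - α l‖ ν ≤ I) :
    rootSize e f D b α ^ (1 / (D : ℝ)) ≤
      (1 + ((Finset.univ : Finset (Fin N)).offDiag.card : ℝ) * (M + 1 : ℕ)) ^ (1 / (D : ℝ)) *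
        I := by
  have hI : 0 ≤ I := le_trans (by positivity) h₀
  have hD' : (D : ℝ) ≠ 0 := by positivity
  have hpow : ∀ x : ℝ, 0 ≤ x → x ^ (1 / (D : ℝ)) ≤ I → x ≤ I ^ D := by
    intro x hx h
    calc x = (x ^ (1 / (D : ℝ))) ^ D := by
          rw [one_div, Real.rpow_inv_natCast_pow hx hD.ne']
      _ ≤ I ^ D := by gcongr
  have hle : rootSize e f D b α ≤
      (1 + ((Finset.univ : Finset (Fin N)).offDiag.card : ℝ) * (M + 1 : ℕ)) * I ^ D := by
    rw [rootSize, add_mul, one_mul]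
    gcongr
    · exact hpow _ (by positivity) (by rwa [pow_rpow_one_div (by positivity)])
    · rw [mul_assoc, ← nsmul_eq_mul]
      refine Finset.sum_le_card_nsmul _ _ _ fun p hp => ?_
      have hden := rootDen_pos f hα hp
      have hne : p.1 ≠ p.2 := by simpa using hp
      rw [rootNum, Finset.sum_div, ← nsmul_eq_mul]
      refine (Finset.sum_le_card_nsmul _ _ (I ^ D) fun ν hν => ?_).trans
        (le_of_eq (by rw [Finset.card_range]))
      refine hpow _ (by positivity) ?_
      rw [← scaleTerm_eq_rpow hD]
      exact h₁ p.1 p.2 hne ⟨ν, Finset.mem_range.1 hν⟩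
  have h0 : 0 ≤ rootSize e f D b α := add_nonneg (by positivity) (Finset.sum_nonneg fun p hp =>
    div_nonneg (rootNum_nonneg ..) (rootDen_pos f hα hp).le)
  calc _ ≤ ((1 + ((Finset.univ : Finset (Fin N)).offDiag.card : ℝ) * (M + 1 : ℕ)) * I ^ D) ^
        (1 / (D : ℝ)) := Real.rpow_le_rpow h0 hle (by positivity)
    _ = _ := by
        rw [Real.mul_rpow (by positivity) (by positivity), one_div,
          Real.pow_rpow_inv_natCast hI hD.ne']

end comparison

/-! ### Location of the roots and the leading coefficient. -/

section rootLocation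

lemma norm_coeff_le_coeffNorm (p : Polynomial ℂ) (n : ℕ) : ‖p.coeff n‖ ≤ coeffNorm p := by
  by_cases h : n ∈ p.support
  · exact Finset.single_le_sum (f := fun n => ‖p.coeff n‖) (fun _ _ => norm_nonneg _) h
  · rw [Polynomial.notMem_support_iff.1 h, norm_zero]
    exact Finset.sum_nonneg fun _ _ => norm_nonneg _

lemma norm_eval_le_coeffNorm {p : Polynomial ℂ} {N : ℕ} (hp : p.natDegree ≤ N) (z : ℂ) :
    ‖p.eval z‖ ≤ coeffNorm p * max 1 ‖z‖ ^ N := by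
  rw [Polynomial.eval_eq_sum, Polynomial.sum, coeffNorm, Finset.sum_mul]
  refine (norm_sum_le _ _).trans (Finset.sum_le_sum fun n hn => ?_)
  rw [norm_mul, norm_pow]
  gcongr
  calc ‖z‖ ^ n ≤ max 1 ‖z‖ ^ n := by
        gcongr
        exact le_max_right _ _
    _ ≤ _ := pow_le_pow_right₀ (le_max_left _ _)
      ((Polynomial.le_natDegree_of_mem_supp n hn).trans hp)

variable {N : ℕ}

lemma natDegree_polyOfCoeffs_le (b : Fin (N + 1) → ℂ) : (polyOfCoeffs b).natDegree ≤ N :=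
  Polynomial.natDegree_sum_le_of_forall_le _ _ fun μ _ =>
    (Polynomial.natDegree_C_mul_X_pow_le _ _).trans (Nat.lt_succ_iff.1 μ.2)

lemma exists_hasRoots {b : Fin (N + 1) → ℂ} (hb : b (Fin.last N) ≠ 0)
    (hnodup : (polyOfCoeffs b).roots.Nodup) :
    ∃ α : Fin N → ℂ, HasRoots b α ∧ Function.Injective α := by
  have hlast : (polyOfCoeffs b).coeff N = b (Fin.last N) := coeff_polyOfCoeffs b (Fin.last N)
  have hdeg : (polyOfCoeffs b).natDegree = N :=
    le_antisymm (natDegree_polyOfCoeffs_le b)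
      (Polynomial.le_natDegree_of_ne_zero (by rwa [hlast]))
  have hsplit := IsAlgClosed.splits (polyOfCoeffs b)
  obtain ⟨l, hl⟩ : ∃ l : List ℂ, (l : Multiset ℂ) = (polyOfCoeffs b).roots :=
    ⟨_, Multiset.coe_toList _⟩
  have hlen : l.length = N := by
    rw [← Multiset.coe_card, hl, ← hsplit.natDegree_eq_card_roots, hdeg]
  refine ⟨fun i => l.get (i.cast hlen.symm), ?_, ?_⟩
  · have h := hsplit.eq_prod_roots
    rw [Polynomial.leadingCoeff, hdeg, hlast, ← hl, Multiset.map_coe, Multiset.prod_coe] at h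
    rw [HasRoots, h, ← List.prod_ofFn]
    congr 2
    exact List.ext_get (by simp [hlen]) fun n h₁ h₂ => by simp
  · refine (List.nodup_iff_injective_get.1 ?_).comp (Fin.cast_injective hlen.symm)
    rwa [← Multiset.coe_nodup, hl]

/-- At a root `a`, `|a| ^ N = |Q(a) - a ^ N|` is at most `coeffNorm (Q - X ^ N) * max 1 |a| ^ N`,
which is impossible for `|a| > 1/4`. -/
lemma HasRoots.norm_root_le {b : Fin (N + 1) → ℂ} {α : Fin N → ℂ} (h : HasRoots b α)
    (hs : coeffNorm (polyOfCoeffs b - Polynomial.X ^ N) < (1 / 4) ^ N / 2) (i : Fin N) :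
    ‖α i‖ ≤ 1 / 4 := by
  by_contra! hlt
  have heval : (polyOfCoeffs b).eval (α i) = 0 := by
    rw [h, Polynomial.eval_mul, Polynomial.eval_prod,
      Finset.prod_eq_zero (Finset.mem_univ i) (by simp), mul_zero]
  have h1 := norm_eval_le_coeffNorm (p := polyOfCoeffs b - Polynomial.X ^ N) (N := N)
    ((Polynomial.natDegree_sub_le _ _).trans (max_le (natDegree_polyOfCoeffs_le b)
      (Polynomial.natDegree_X_pow_le N))) (α i)
  rw [Polynomial.eval_sub, heval, zero_sub, norm_neg, Polynomial.eval_pow, Polynomial.eval_X,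
    norm_pow] at h1
  have h4 : ((1 : ℝ) / 4) ^ N < ‖α i‖ ^ N ∨ N = 0 := by
    rcases Nat.eq_zero_or_pos N with h0 | h0
    · exact Or.inr h0
    · exact Or.inl (pow_lt_pow_left₀ hlt (by norm_num) h0.ne')
  have h5 : ((1 : ℝ) / 4) ^ N < ‖α i‖ ^ N := h4.resolve_right fun h0 => by
    subst h0
    exact i.elim0
  have h6 : (0 : ℝ) < (1 / 4) ^ N := by positivity
  have h7 : ((1 : ℝ) / 4) ^ N ≤ 1 := pow_le_one₀ (by norm_num) (by norm_num)
  rcases le_total ‖α i‖ 1 with hle | hle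
  · rw [max_eq_left hle, one_pow, mul_one] at h1
    linarith
  · rw [max_eq_right hle] at h1
    have : (1 : ℝ) ≤ ‖α i‖ ^ N := one_le_pow₀ hle
    nlinarith

lemma norm_sub_one_lt_of_coeffNorm_lt {b : Fin (N + 1) → ℂ} {s : ℝ}
    (hs : coeffNorm (polyOfCoeffs b - Polynomial.X ^ N) < s) : ‖b (Fin.last N) - 1‖ < s := by
  have h := norm_coeff_le_coeffNorm (polyOfCoeffs b - Polynomial.X ^ N) N
  have hlast : (polyOfCoeffs b).coeff N = b (Fin.last N) := coeff_polyOfCoeffs b (Fin.last N)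
  rw [Polynomial.coeff_sub, hlast, Polynomial.coeff_X_pow_self] at h
  exact h.trans_lt hs

end rootLocation

/-! ### Assembly. -/

lemma exists_common_denominator {ε δ : ℚ} (hε : 0 ≤ ε) (hδ : 0 ≤ δ) :
    ∃ e f D : ℕ, 0 < D ∧ (ε : ℝ) = (e : ℝ) / D ∧ (δ : ℝ) = (f : ℝ) / D := by
  lift ε to ℚ≥0 using hε
  lift δ to ℚ≥0 using hδ
  have h1 : (ε.den : ℝ) ≠ 0 := by exact_mod_cast ε.den_ne_zero
  have h2 : (δ.den : ℝ) ≠ 0 := by exact_mod_cast δ.den_ne_zero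
  refine ⟨ε.num * δ.den, δ.num * ε.den, ε.den * δ.den, Nat.mul_pos ε.den_pos δ.den_pos, ?_, ?_⟩
  · rw [Rat.cast_nnratCast, NNRat.cast_def]
    push_cast
    field_simp
  · rw [Rat.cast_nnratCast, NNRat.cast_def]
    push_cast
    field_simp

end measure

theorem theorem5 (M N : ℕ) (ε δ : ℚ) (hε : 0 ≤ ε) (hδ : 0 ≤ δ) (hδ2 : δ < 2)
    (hnd : Nondegenerate M N ε δ) :
    ∃ (T : ARP (Fin (M + 1) ⊕ Fin (N + 1)) ℤ) (s₁ : ℝ), 0 < s₁ ∧ s₁ < 1 ∧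
      ∃ c C : ℝ, 0 < c ∧ 0 < C ∧
        ∀ (b' : Fin (M + 1) → ℂ) (b'' : Fin (N + 1) → ℂ), b' ≠ 0 →
          (polyOfCoeffs b'').roots.Nodup →
          coeffNorm (polyOfCoeffs b'' - Polynomial.X ^ N) < s₁ →
            Sum.elim b' b'' ∈ T.strictDomain ∧
            MeasureTheory.IntegrableOn
              (fun z : ℂ => ‖(polyOfCoeffs b').eval z‖ ^ (ε : ℝ) /
                ‖(polyOfCoeffs b'').eval z‖ ^ (δ : ℝ))
              (Metric.ball (0 : ℂ) 1) MeasureTheory.volume ∧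
            c * T.eval (Sum.elim b' b'') ≤
              ∫ z in Metric.ball (0 : ℂ) 1, ‖(polyOfCoeffs b').eval z‖ ^ (ε : ℝ) /
                ‖(polyOfCoeffs b'').eval z‖ ^ (δ : ℝ) ∧
            ∫ z in Metric.ball (0 : ℂ) 1, ‖(polyOfCoeffs b').eval z‖ ^ (ε : ℝ) /
                ‖(polyOfCoeffs b'').eval z‖ ^ (δ : ℝ) ≤
              C * T.eval (Sum.elim b' b'') := by
  have hε' : (0 : ℝ) ≤ ε := by exact_mod_cast hε
  have hδ' : (0 : ℝ) ≤ δ := by exact_mod_cast hδ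
  have hδ2' : (δ : ℝ) < 2 := by exact_mod_cast hδ2
  obtain ⟨η, hη, hgap⟩ := hnd.exists_gap
  obtain ⟨C₁, hC₁, hupper⟩ := exists_setIntegral_le M N hε' hδ' hδ2' hη hgap
  obtain ⟨c₁, hc₁, hlower⟩ := exists_le_setIntegral M N hε' hδ'
  obtain ⟨e, f, D, hD, heD, hfD⟩ := exists_common_denominator hε hδ
  obtain ⟨T, c₂, C₂, hc₂, hC₂, hT⟩ := exists_arp_comparable_rootSize M N e f D hD
  set n : ℝ := 1 + ((Finset.univ : Finset (Fin N)).offDiag.card : ℝ) * (M + 1 : ℕ) with hn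
  have hnpos : 0 < n := by positivity
  have h4 : ((1 : ℝ) / 4) ^ N ≤ 1 := pow_le_one₀ (by norm_num) (by norm_num)
  -- This `s₁` confines the roots to radius `1/4` and, being at most `1/2`, keeps the leading
  -- coefficient within `1/2` of `1`.
  refine ⟨T, (1 / 4) ^ N / 2, by positivity, by linarith,
    c₁ * c₂ / n ^ (1 / (D : ℝ)), C₁ * (n * C₂), by positivity, by positivity,
    fun b' b'' hb hnodup hs => ?_⟩
  have hlead : ‖b'' (Fin.last N) - 1‖ < 1 / 2 :=
    (norm_sub_one_lt_of_coeffNorm_lt hs).trans_le (by linarith)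
  have hlo : 1 / 2 ≤ ‖b'' (Fin.last N)‖ := by
    have := norm_sub_norm_le (1 : ℂ) (b'' (Fin.last N))
    rw [norm_sub_rev, norm_one] at this
    linarith
  have hhi : ‖b'' (Fin.last N)‖ ≤ 2 := by
    have := norm_sub_norm_le (b'' (Fin.last N)) 1
    rw [norm_one] at this
    linarith
  obtain ⟨α, hr, hα⟩ := exists_hasRoots (b := b'') (fun h0 => by
    rw [h0] at hlo
    norm_num at hlo) hnodup
  have hα4 := hr.norm_root_le hs
  obtain ⟨hdom, hT₁, hT₂⟩ := hT b' b'' α hb hα hr hlo hhi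
  obtain ⟨hint, hle⟩ := hupper b' b'' α hr hlo hα4 hα
  obtain ⟨hl₀, hl₁⟩ := hlower b' b'' α hr hlo hhi hα4 hα hint
  refine ⟨hdom, hint, ?_, ?_⟩
  · change _ ≤ ∫ z in Metric.ball 0 1, normRatio ε δ (polyOfCoeffs b') (polyOfCoeffs b'') z
    set I := ∫ z in Metric.ball 0 1, normRatio ε δ (polyOfCoeffs b') (polyOfCoeffs b'') z
    have h := rootSize_le_of_scaleTerm_le (e := e) (f := f) hD b' hα (I := I / c₁)
      (by rw [← heD, le_div_iff₀' hc₁]; exact hl₀)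
      (fun i l hil ν => by rw [← heD, ← hfD, le_div_iff₀' hc₁]; exact hl₁ i l hil ν)
    rw [← hn] at h
    have hq : 0 < n ^ (1 / (D : ℝ)) := by positivity
    calc c₁ * c₂ / n ^ (1 / (D : ℝ)) * T.eval (Sum.elim b' b'')
        = c₁ / n ^ (1 / (D : ℝ)) * (c₂ * T.eval (Sum.elim b' b'')) := by ring
      _ ≤ c₁ / n ^ (1 / (D : ℝ)) * (n ^ (1 / (D : ℝ)) * (I / c₁)) := by
          exact mul_le_mul_of_nonneg_left (hT₁.trans h) (by positivity)
      _ = I := by field_simp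
  · change ∫ z in Metric.ball 0 1, normRatio ε δ (polyOfCoeffs b') (polyOfCoeffs b'') z ≤ _
    have h := scaleSum_le_rootSize (e := e) (f := f) hD b' hα
    rw [← heD, ← hfD, ← hn] at h
    calc _ ≤ C₁ * scaleSum ε δ b' α := hle
      _ ≤ C₁ * (n * (C₂ * T.eval (Sum.elim b' b''))) := by
          gcongr
          exact h.trans (by gcongr)
      _ = _ := by ring
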